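/- Let $\mathbb K\in\{\mathbb R,\mathbb C\}$ and let $\mathfrak g$ be a Hausdorff locally convex Lie algebra over $\mathbb K$ (that is, a Lie algebra whose underlying vector space is a Hausdorff locally convex space and whose bracket is jointly continuous). Put $\mathfrak g^{(1)}=\mathfrak g$ and $\mathfrak g^{(j+1)}=[\mathfrak g,\mathfrak g^{(j)}]$ for $j\ge 1$, and assume that $\mathfrak g^{(N)}\neq\{0\}=\mathfrak g^{(N+1)}$ for some integer $N\ge 1$. Let $G=(\mathfrak g,*)$ be the group whose operation $*$ is given by the Baker–Campbell–Hausdorff formula (a finite sum, since $\mathfrak g$ is nilpotent). Let $\mathcal C(\mathfrak g,\mathbb K)$ be the space of continuous functions $\mathfrak g\to\mathbb K$ with the topology of uniform convergence on bounded sets, let $\mathcal P_N(\mathfrak g,\mathbb K)\subseteq\mathcal C(\mathfrak g,\mathbb K)$ be the space of continuous polynomial functions of degree $\le N$ (sums of restrictions to the diagonal of continuous $j$-linear forms, $0\le j\le N$), and let $\mathfrak g^*$ be the space of continuous linear functionals on $\mathfrak g$. For $x,y\in\mathfrak g$ and $\phi\in\mathcal C(\mathfrak g,\mathbb K)$ put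 $$(\lambda(x)\phi)(y)=\phi((-x)*y),\qquad (\dot\lambda(x)\phi)(y)=\lim_{t\to0}\frac{\phi((-tx)*y)-\phi(y)}{t},$$ the latter whenever the limit ($t\in\mathbb K\setminus\{0\}$) exists, and let $$\mathcal F_G=\overline{\operatorname{span}}\,\bigl(\lambda(G)\mathfrak g^*\bigr)$$ be the closed linear span in $\mathcal C(\mathfrak g,\mathbb K)$, with the induced topology. Then the following assertions hold. 1. $\mathcal F_G$ is a closed linear subspace of $\mathcal C(\mathfrak g,\mathbb K)$ contained in $\mathcal P_N(\mathfrak g,\mathbb K)$; it is invariant under $\lambda(x)$ for every $x\in G$ and contains the constant functions. 2. The mapping $x\mapsto\lambda_G(x):=\lambda(x)|_{\mathcal F_G}$ is a faithful (injective) representation of the group $G$ by continuous linear operators on $\mathcal F_G$. It is smooth, in the sense that for every $\phi\in\mathcal F_G$ the orbit map $G\to\mathcal F_G$, $x\mapsto\lambda_G(x)\phi$, is smooth (in the sense of Michal–Bastiani: all iterated directional derivatives exist and are continuous). Moreover $(\lambda_G(x)-\mathbf 1)^{2^{N-1}N+1}=0$ for every $x\in G$. 3. For all $x\in\mathfrak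 g$ and $\phi\in\mathcal F_G$ the function $\dot\lambda(x)\phi$ exists and belongs to $\mathcal F_G$, and it equals $\lim_{t\to0}t^{-1}(\lambda_G(tx)\phi-\phi)$ in the topology of $\mathcal F_G$. The mapping $x\mapsto\dot\lambda_G(x):=\dot\lambda(x)|_{\mathcal F_G}$ is a faithful (injective) representation of the Lie algebra $\mathfrak g$ by continuous linear operators on $\mathcal F_G$, and $\dot\lambda_G(x)^{2^{N-1}N+1}=0$ for every $x\in\mathfrak g$. -/

import Mathlib

open Filter Topology
open scoped UniformConvergence

universe u v

/-- Joint continuity of the Lie bracket: the compatibility between bracket and topology in the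
definition of a topological (in particular, locally convex) Lie algebra. -/
class ContinuousLieBracket (𝔤 : Type u) [LieRing 𝔤] [TopologicalSpace 𝔤] : Prop where
  continuous_bracket : Continuous fun p : 𝔤 × 𝔤 => ⁅p.1, p.2⁆

noncomputable section

section BCH

variable (𝕜 : Type v) [RCLike 𝕜] {𝔤 : Type u} [LieRing 𝔤] [LieAlgebra 𝕜 𝔤]

/-- The Baker-Campbell-Hausdorff product, in Dynkin's form
`x ∗ y = x + ∑ (-1)^k / ((k+1) (q₁+⋯+q_k+1))
    (ad x)^{p₁} (ad y)^{q₁} ⋯ (ad x)^{p_k} (ad y)^{q_k} (ad x)^m y / (p₁! q₁! ⋯ p_k! q_k! m!)`,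
the sum being over `k, m ≥ 0` and `(p_i, q_i) ≠ (0, 0)`.
If all brackets of more than `N` elements vanish, then a term can be nonzero only if
`k`, `m`, `p_i`, `q_i` are all `< N`, so this finite sum is the whole series. -/
def bch (N : ℕ) (x y : 𝔤) : 𝔤 :=
  x + ∑ k ∈ Finset.range N,
    ∑ p ∈ Fintype.piFinset
        (fun _ : Fin k => (Finset.range N ×ˢ Finset.range N).erase ((0, 0) : ℕ × ℕ)),
      ∑ m ∈ Finset.range N,
        ((-1 : 𝕜) ^ k /
            ((k + 1) * ((∑ i, ((p i).2 : 𝕜)) + 1) *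
              (∏ i, (((p i).1.factorial : 𝕜) * ((p i).2.factorial : 𝕜))) * (m.factorial : 𝕜))) •
          ((List.ofFn fun i : Fin k =>
              LieAlgebra.ad 𝕜 𝔤 x ^ (p i).1 * LieAlgebra.ad 𝕜 𝔤 y ^ (p i).2).prod *
            LieAlgebra.ad 𝕜 𝔤 x ^ m) y

variable [TopologicalSpace 𝔤]

theorem continuous_ad_pow_apply [ContinuousLieBracket 𝔤] (n : ℕ) {f g : 𝔤 → 𝔤}
    (hf : Continuous f) (hg : Continuous g) :
    Continuous fun y => (LieAlgebra.ad 𝕜 𝔤 (f y) ^ n) (g y) := by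
  induction n with
  | zero => simpa using hg
  | succ n ih =>
    simp only [pow_succ', Module.End.mul_apply, LieAlgebra.ad_apply]
    exact ContinuousLieBracket.continuous_bracket.comp (hf.prodMk ih)

theorem continuous_bch_right [IsTopologicalAddGroup 𝔤] [ContinuousConstSMul 𝕜 𝔤]
    [ContinuousLieBracket 𝔤] (N : ℕ) (x : 𝔤) : Continuous fun y => bch 𝕜 N x y := by
  unfold bch
  refine continuous_const.add (continuous_finsetSum _ fun k _ => continuous_finsetSum _
    fun p _ => continuous_finsetSum _ fun m _ => Continuous.const_smul ?_ _)
  simp only [Module.End.mul_apply]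
  have key : ∀ (l : List (ℕ × ℕ)) {g : 𝔤 → 𝔤}, Continuous g → Continuous fun y =>
      ((l.map fun q => LieAlgebra.ad 𝕜 𝔤 x ^ q.1 * LieAlgebra.ad 𝕜 𝔤 y ^ q.2).prod) (g y) := by
    intro l g hg
    induction l with
    | nil => simpa using hg
    | cons q l ih =>
      simp only [List.map_cons, List.prod_cons, Module.End.mul_apply]
      exact continuous_ad_pow_apply 𝕜 _ continuous_const
        (continuous_ad_pow_apply 𝕜 _ continuous_id ih)
  have := key (List.ofFn p) (continuous_ad_pow_apply 𝕜 m continuous_const continuous_id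
    (f := fun _ => x))
  simpa only [List.map_ofFn, Function.comp_def, id] using this

end BCH

section FunctionSpaces

variable (𝕜 : Type v) [RCLike 𝕜] (𝔤 : Type u) [TopologicalSpace 𝔤]

/-- The space of continuous functions `𝔤 → 𝕜`, with the pointwise vector space structure; a copy
of `C(𝔤, 𝕜)`, which Mathlib equips with the compact-open topology. -/
def ContFun : Type (max u v) := C(𝔤, 𝕜)

namespace ContFun

instance instAddCommGroup : AddCommGroup (ContFun 𝕜 𝔤) := inferInstanceAs (AddCommGroup C(𝔤, 𝕜))

instance instModule : Module 𝕜 (ContFun 𝕜 𝔤) := inferInstanceAs (Module 𝕜 C(𝔤, 𝕜))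

instance instFunLike : FunLike (ContFun 𝕜 𝔤) 𝔤 𝕜 := inferInstanceAs (FunLike C(𝔤, 𝕜) 𝔤 𝕜)

variable {𝕜 𝔤}

/-- A continuous function as an element of `ContFun`. -/
def mk (f : 𝔤 → 𝕜) (hf : Continuous f) : ContFun 𝕜 𝔤 := (⟨f, hf⟩ : C(𝔤, 𝕜))

@[simp] theorem mk_apply (f : 𝔤 → 𝕜) (hf : Continuous f) (y : 𝔤) : mk f hf y = f y := rfl

@[simp] theorem add_apply (φ ψ : ContFun 𝕜 𝔤) (y : 𝔤) : (φ + ψ) y = φ y + ψ y := rfl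

@[simp] theorem smul_apply (c : 𝕜) (φ : ContFun 𝕜 𝔤) (y : 𝔤) : (c • φ) y = c * φ y := rfl

@[simp] theorem zero_apply (y : 𝔤) : (0 : ContFun 𝕜 𝔤) y = 0 := rfl

theorem continuous (φ : ContFun 𝕜 𝔤) : Continuous φ := ContinuousMap.continuous (Y := 𝕜) φ

variable (𝕜 𝔤) [AddCommGroup 𝔤] [Module 𝕜 𝔤]

/-- The inclusion into the space of all functions, the latter with the topology of uniform
convergence on the (von Neumann) bounded subsets of `𝔤`. -/
def toUniformOn : ContFun 𝕜 𝔤 →+ (𝔤 →ᵤ[{B : Set 𝔤 | Bornology.IsVonNBounded 𝕜 B}] 𝕜) where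
  toFun φ := UniformOnFun.ofFun _ φ
  map_zero' := rfl
  map_add' _ _ := rfl

/-- The topology of uniform convergence on the bounded subsets of `𝔤`. -/
instance instTopologicalSpace : TopologicalSpace (ContFun 𝕜 𝔤) :=
  TopologicalSpace.induced (toUniformOn 𝕜 𝔤) inferInstance

instance instIsTopologicalAddGroup : IsTopologicalAddGroup (ContFun 𝕜 𝔤) :=
  topologicalAddGroup_induced (toUniformOn 𝕜 𝔤)

instance instContinuousConstSMul : ContinuousConstSMul 𝕜 (ContFun 𝕜 𝔤) :=
  Topology.IsInducing.continuousConstSMul (g := toUniformOn 𝕜 𝔤) ⟨rfl⟩ id (fun {_ _} => rfl)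

end ContFun

variable [AddCommGroup 𝔤] [Module 𝕜 𝔤]

instance instContinuousConstSMulSubmodule (S : Submodule 𝕜 (ContFun 𝕜 𝔤)) :
    ContinuousConstSMul 𝕜 S :=
  ⟨fun c => (continuous_subtype_val.const_smul c).subtype_mk _⟩

/-- The continuous polynomial functions of degree `≤ m`: the sums of the restrictions to the
diagonal of continuous `j`-linear forms, `j = 0, …, m`. -/
def ContPoly (m : ℕ) : Submodule 𝕜 (ContFun 𝕜 𝔤) where
  carrier := {φ | ∃ A : ∀ j : ℕ, ContinuousMultilinearMap 𝕜 (fun _ : Fin j => 𝔤) 𝕜,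
    ∀ y, φ y = ∑ j ∈ Finset.range (m + 1), A j (fun _ => y)}
  add_mem' := by
    rintro f g ⟨A, hA⟩ ⟨B, hB⟩
    exact ⟨fun j => A j + B j, fun y => by simp [hA, hB, Finset.sum_add_distrib]⟩
  zero_mem' := ⟨fun _ => 0, fun y => by simp⟩
  smul_mem' := by
    rintro c f ⟨A, hA⟩
    exact ⟨fun j => c • A j, fun y => by simp [hA, Finset.mul_sum]⟩

end FunctionSpaces

section RegularRepresentation

variable (𝕜 : Type v) [RCLike 𝕜] {𝔤 : Type u} [LieRing 𝔤] [LieAlgebra 𝕜 𝔤]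
  [TopologicalSpace 𝔤] [IsTopologicalAddGroup 𝔤] [ContinuousConstSMul 𝕜 𝔤]
  [ContinuousLieBracket 𝔤]

/-- The left regular representation, `(λ(x)φ)(y) = φ((-x) ∗ y)`. -/
def leftReg (N : ℕ) (x : 𝔤) : ContFun 𝕜 𝔤 →ₗ[𝕜] ContFun 𝕜 𝔤 where
  toFun φ := ContFun.mk (fun y => φ (bch 𝕜 N (-x) y))
    (φ.continuous.comp (continuous_bch_right 𝕜 N (-x)))
  map_add' _ _ := rfl
  map_smul' _ _ := rfl

variable (𝔤)

/-- `F_G`, the closed linear span of `λ(G)𝔤*` in the space of continuous functions. -/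
def FG (N : ℕ) : Submodule 𝕜 (ContFun 𝕜 𝔤) :=
  (Submodule.span 𝕜 {φ | ∃ (x : 𝔤) (ξ : 𝔤 →L[𝕜] 𝕜),
    φ = leftReg 𝕜 N x (ContFun.mk ξ ξ.continuous)}).topologicalClosure

variable {𝔤}

/-- `λ̇(x)φ` exists and equals `ψ`, that is,
`ψ(y) = lim_{t → 0} (φ((-tx) ∗ y) - φ(y)) / t` for all `y`. -/
def IsLambdaDot (N : ℕ) (x : 𝔤) (φ ψ : ContFun 𝕜 𝔤) : Prop :=
  ∀ y : 𝔤, Tendsto (fun t : 𝕜 => (φ (bch 𝕜 N (-(t • x)) y) - φ y) / t)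
    (𝓝[≠] 0) (𝓝 (ψ y))

end RegularRepresentation

section Smooth

/-- `C^k`-maps between topological vector spaces in the sense of Michal and Bastiani:
`f` is `C^0` if it is continuous, and `C^{k+1}` if it is continuous, all its directional
derivatives `df(x, v)` exist and `df : E × E → F` is `C^k`. -/
def IsCk (𝕜 : Type*) [RCLike 𝕜] {F : Type*} [AddCommGroup F] [Module 𝕜 F] [TopologicalSpace F] :
    ℕ → ∀ (E : Type u) [AddCommGroup E] [Module 𝕜 E] [TopologicalSpace E], (E → F) → Prop
  | 0, _, _, _, _, f => Continuous f
  | k + 1, E, _, _, _, f => Continuous f ∧ ∃ df : E × E → F,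
      (∀ x v : E, Tendsto (fun t : 𝕜 => t⁻¹ • (f (x + t • v) - f x)) (𝓝[≠] 0) (𝓝 (df (x, v)))) ∧
        IsCk 𝕜 k (E × E) df

/-- Smooth maps between topological vector spaces (Michal-Bastiani calculus). -/
def IsSmoothMap (𝕜 : Type*) [RCLike 𝕜] {F : Type*} [AddCommGroup F] [Module 𝕜 F]
    [TopologicalSpace F] {E : Type u} [AddCommGroup E] [Module 𝕜 E] [TopologicalSpace E]
    (f : E → F) : Prop :=
  ∀ k : ℕ, IsCk 𝕜 k E f

end Smooth

end

/-! The algebraic half of the proof shows that `bch` is a group law; the analytic half reduces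
everything on `FG` to polynomials in one variable.

Algebra. For suitable nilpotent `a`, `b` in an associative algebra put `Z(X) = log (e^a e^{Xb})`.
Differentiating `e^Z` gives `((e^{ad Z} - 1) / ad Z) Z' = e^{ad Z} b`. Inverting the operator on the
left by the series of `log (1 + u) / u`, inserting `e^{ad Z} = e^{ad a} e^{X ad b}` and integrating
over `[0, 1]` produces Dynkin's formula (`exp_bch`). Moving this to `𝔤` needs a representation by
nilpotent operators that separates points, and the adjoint one loses the centre. So `𝔤` is replaced
by `𝕜[X] ⊗ 𝔤` with its Euler derivation `E`, acting on `(𝕜[X] ⊗ 𝔤) × 𝕜` so that `l` sends `(0, 1)`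
to `(E l, 0)`; this determines `l` up to constants in `X`. Identities for `X ⊗ x`, `X ⊗ y`, `X ⊗ z`
thus hold after applying `E`; both sides agree at `X = 0`, and evaluation at `X = 1` gives the
identity in `𝔤`. This yields associativity (`bch_assoc`) and `x ∗ y ∗ (-x) = e^{ad x} y`
(`bch_conj`).

Analysis. Since long brackets vanish, `bch` of two curves of degree `m` is a curve of degree at most
`N m`. Translates of functionals are therefore polynomials of degree at most `N` along lines.
Lagrange interpolation at `0, …, D` turns this into equations between point values, so it survives
the closure (`comp_mem_polyCurve_of_mem_FG`). The same interpolation writes derivatives as finite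
combinations of values, which gives multilinear Taylor terms and smoothness, and it controls a
polynomial on a bounded set by its size near `0` (`ContFun.continuous_of_isLinePoly`).

Along the flow `t ↦ (-tx) ∗ y` an element of `FG` is a polynomial in `t` of degree at most `N²`;
there `λ(x) - 1` acts as a forward difference and `λ̇(x)` as `d/dt`. Hence both are nilpotent,
because `N² ≤ 2^(N-1) N`. The bracket relation is the derivative at `t = 0` of `λ(tx) λ̇(y) =
λ̇(e^{t ad x} y) λ(tx)`. Constants come from a nonzero central element, faithfulness from
Hahn-Banach and evaluation at `0`. -/

section TruncatedSeries

/-! ### Truncated exponential and logarithm of nilpotent elements. -/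

open Polynomial

/-- The truncation `∑_{i < M} X^i / (i+1)!` of the power series `(e^X - 1) / X`. -/
noncomputable def expDiv (M : ℕ) : ℚ[X] :=
  ∑ i ∈ Finset.range M, C (((i + 1).factorial : ℚ)⁻¹) * X ^ i

/-- The truncation `∑_{k < M} (-1)^k X^k / (k+1)` of the power series `log (1 + X) / X`. -/
noncomputable def logDiv (M : ℕ) : ℚ[X] :=
  ∑ k ∈ Finset.range M, C ((-1 : ℚ) ^ k / (k + 1)) * X ^ k

theorem derivative_X_mul_logDiv (M : ℕ) :
    (1 + X) * derivative (X * logDiv M) = 1 - (-X : ℚ[X]) ^ M := by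
  have h : derivative (X * logDiv M) = ∑ k ∈ Finset.range M, (-X : ℚ[X]) ^ k := by
    rw [logDiv, Finset.mul_sum, derivative_sum]
    refine Finset.sum_congr rfl fun k _ => ?_
    have hk : (k + 1 : ℚ) ≠ 0 := by positivity
    rw [show (X : ℚ[X]) * (C ((-1 : ℚ) ^ k / (k + 1)) * X ^ k)
      = C ((-1 : ℚ) ^ k / (k + 1)) * X ^ (k + 1) by ring, derivative_C_mul_X_pow]
    push_cast
    rw [div_mul_cancel₀ _ hk, neg_pow (X : ℚ[X])]
    simp
  rw [h, show (1 + X : ℚ[X]) = 1 - (-X) by ring, mul_neg_geom_sum]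

theorem derivative_X_mul_expDiv (M : ℕ) :
    derivative (X * expDiv M) = 1 + X * expDiv M - C ((M.factorial : ℚ)⁻¹) * X ^ M := by
  induction M with
  | zero => simp [expDiv]
  | succ M ih =>
    have h : X * expDiv (M + 1)
        = X * expDiv M + C (((M + 1).factorial : ℚ)⁻¹) * X ^ (M + 1) := by
      simp only [expDiv, Finset.sum_range_succ]; ring
    have hM : (((M + 1).factorial : ℚ)⁻¹) * ((M + 1 : ℕ) : ℚ) = (M.factorial : ℚ)⁻¹ := by
      rw [Nat.factorial_succ]; push_cast
      have : (M + 1 : ℚ) ≠ 0 := by positivity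
      field_simp
    rw [h, derivative_add, ih, derivative_C_mul_X_pow, hM, Nat.add_sub_cancel]
    ring

/-- This is `log (e^X) = X` modulo truncation. With `P = X * expDiv M` in the role of `e^X - 1`, one
has `P' ≡ 1 + P`, so the derivative of `log (1 + P) - X` vanishes modulo `X^M`; comparing
coefficients removes the derivative. -/
theorem X_pow_dvd_logDiv_comp (M : ℕ) :
    (X : ℚ[X]) ^ M ∣ (logDiv (M + 1)).comp (X * expDiv M) * expDiv M - 1 := by
  set P : ℚ[X] := X * expDiv M with hP
  set H := (logDiv (M + 1)).comp P * expDiv M with hH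
  have h1 : (X * logDiv (M + 1)).comp P = X * H := by
    rw [mul_comp, X_comp, hH, hP]; ring
  have h2 : derivative (X * H) = derivative P * (derivative (X * logDiv (M + 1))).comp P := by
    rw [← h1, derivative_comp]
  have h3 := congrArg (fun q : ℚ[X] => q.comp P) (derivative_X_mul_logDiv (M + 1))
  simp only [mul_comp, add_comp, one_comp, X_comp, sub_comp, pow_comp, neg_comp] at h3
  have hd : (X : ℚ[X]) ^ M ∣ derivative (X * (H - 1)) := by
    rw [mul_sub, derivative_sub, h2, hP, derivative_X_mul_expDiv, ← hP, sub_mul, mul_one,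
      derivative_X, h3]
    have : (1 : ℚ[X]) - (-P) ^ (M + 1)
        - C ((M.factorial : ℚ)⁻¹) * X ^ M * (derivative (X * logDiv (M + 1))).comp P - 1
        = X ^ M * (-((-1) ^ (M + 1) * X * expDiv M ^ (M + 1))
          - C ((M.factorial : ℚ)⁻¹) * (derivative (X * logDiv (M + 1))).comp P) := by
      rw [neg_pow, hP, mul_pow]; ring
    rw [this]; exact dvd_mul_right _ _
  rw [X_pow_dvd_iff] at hd ⊢
  -- The coefficient of `X^d` in `(X q)'` is `d + 1` times that of `q`, and `d + 1` is invertible in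
  -- `ℚ`.
  intro d hdM
  have := hd d hdM
  rw [coeff_derivative, coeff_X_mul] at this
  have hne : (d + 1 : ℚ) ≠ 0 := by positivity
  exact (mul_eq_zero.mp this).resolve_right hne

variable {R : Type*} [Ring R] [Algebra ℚ R]

theorem exp_eq_one_add {w : R} {M : ℕ} (hw : w ^ M = 0) :
    IsNilpotent.exp w = 1 + w * aeval w (expDiv M) := by
  rw [IsNilpotent.exp_eq_sum (k := M + 1) (by rw [pow_succ, hw, zero_mul]),
    Finset.sum_range_succ', add_comm]
  simp [expDiv, Finset.mul_sum, ← Algebra.smul_def, pow_succ']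

/-- The truncated logarithm `∑_{k < M} (-1)^k u^(k+1) / (k+1)` of `1 + u`. -/
noncomputable def nilLog (M : ℕ) (u : R) : R := u * aeval u (logDiv M)

theorem aeval_logDiv_mul_aeval_expDiv {w : R} {M : ℕ} (hw : w ^ M = 0) :
    aeval (IsNilpotent.exp w - 1) (logDiv (M + 1)) * aeval w (expDiv M) = 1 := by
  obtain ⟨Q, hQ⟩ := X_pow_dvd_logDiv_comp M
  have := congrArg (aeval w) hQ
  rw [map_sub, map_mul, aeval_comp, map_mul, aeval_X, map_mul, map_pow, aeval_X, hw, zero_mul,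
    map_one, sub_eq_zero] at this
  rwa [exp_eq_one_add hw, add_sub_cancel_left]

theorem nilLog_exp {w : R} {M : ℕ} (hw : w ^ M = 0) :
    nilLog (M + 1) (IsNilpotent.exp w - 1) = w := by
  have h := aeval_logDiv_mul_aeval_expDiv hw
  have hc : Commute (aeval w (expDiv M)) (aeval (IsNilpotent.exp w - 1) (logDiv (M + 1))) := by
    rw [exp_eq_one_add hw, add_sub_cancel_left]
    have e1 : w * aeval w (expDiv M) = aeval w (X * expDiv M) := by simp
    rw [e1, ← aeval_comp]
    exact (Commute.all _ _).map (aeval w)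
  rw [nilLog]
  nth_rewrite 1 [exp_eq_one_add hw]
  rw [add_sub_cancel_left, mul_assoc, hc.eq, h, mul_one]

theorem exp_injective_of_nilpotent {w w' : R} (hw : IsNilpotent w) (hw' : IsNilpotent w')
    (h : IsNilpotent.exp w = IsNilpotent.exp w') : w = w' := by
  obtain ⟨m, hm⟩ := hw
  obtain ⟨n, hn⟩ := hw'
  rw [← nilLog_exp (pow_eq_zero_of_le (le_max_left m n) hm), h,
    nilLog_exp (pow_eq_zero_of_le (le_max_right m n) hn)]

theorem nilLog_pow_eq_zero {u : R} {n : ℕ} (hu : u ^ n = 0) (M : ℕ) : nilLog M u ^ n = 0 := by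
  have hc : Commute u (aeval u (logDiv M)) := by
    have := (Commute.all X (logDiv M)).map (aeval u)
    rwa [aeval_X] at this
  rw [nilLog, hc.mul_pow, hu, zero_mul]

end TruncatedSeries

/-! ### Derivations of powers in a noncommutative ring. -/

section Derivations

attribute [local instance] LieRing.ofAssociativeRing

variable {𝕜 : Type*} [Field 𝕜] {S : Type*} [Ring S] [Algebra 𝕜 S]

/-- All powers of `Z` are moved to the right of `δ Z` by `Z A = (ad Z) A + A Z`; Pascal's rule
collects the terms. -/
theorem derivation_pow (δ : S →+ S) (hδ : ∀ a b, δ (a * b) = δ a * b + a * δ b) (Z : S) (n : ℕ) :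
    δ (Z ^ n) = ∑ k ∈ Finset.range n,
      n.choose (k + 1) • ((LieAlgebra.ad 𝕜 S Z ^ k) (δ Z) * Z ^ (n - 1 - k)) := by
  induction n with
  | zero =>
    have := hδ 1 1
    simp at this
    simp [this]
  | succ n ih =>
    have hstep : ∀ A : S, Z * A = LieAlgebra.ad 𝕜 S Z A + A * Z := fun A => by
      simp [LieAlgebra.ad_apply, LieRing.of_associative_ring_bracket]
    have e : ∀ k ∈ Finset.range n, Z * (n.choose (k + 1) • ((LieAlgebra.ad 𝕜 S Z ^ k) (δ Z) *
        Z ^ (n - 1 - k))) = n.choose (k + 1) • ((LieAlgebra.ad 𝕜 S Z ^ (k + 1)) (δ Z) *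
        Z ^ (n - (k + 1))) + n.choose (k + 1) • ((LieAlgebra.ad 𝕜 S Z ^ k) (δ Z) *
        Z ^ (n - k)) := by
      intro k hk
      have hk := Finset.mem_range.mp hk
      rw [mul_smul_comm, ← mul_assoc, hstep, add_mul, ← smul_add, ← Module.End.mul_apply,
        ← pow_succ', mul_assoc, ← pow_succ', show n - 1 - k + 1 = n - k by lia,
        show n - 1 - k = n - (k + 1) by lia]
    rw [pow_succ', hδ, ih, Finset.mul_sum, Finset.sum_congr rfl e, Finset.sum_add_distrib,
      Nat.add_sub_cancel]
    simp only [Nat.choose_succ_succ' n, add_smul, Finset.sum_add_distrib]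
    rw [Finset.sum_range_succ' _ n, Finset.sum_range_succ (fun k => n.choose (k + 1) • _) n]
    simp
    abel

theorem sum_range_antidiagonal_of_vanish {G : Type*} [AddCommMonoid G] (M : ℕ) (f : ℕ → ℕ → G)
    (h1 : ∀ i j, M ≤ i → f i j = 0) (h2 : ∀ i j, M ≤ j → f i j = 0) :
    ∑ n ∈ Finset.range (2 * M), ∑ p ∈ Finset.HasAntidiagonal.antidiagonal n, f p.1 p.2
      = ∑ i ∈ Finset.range M, ∑ j ∈ Finset.range M, f i j := by
  rw [← Finset.sum_product', ← Finset.sum_fiberwise_of_maps_to (t := Finset.range (2 * M))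
    (g := fun p : ℕ × ℕ => p.1 + p.2)]
  · refine Finset.sum_congr rfl fun n _ => (Finset.sum_subset ?_ ?_).symm
    · intro p hp
      simp only [Finset.mem_filter, Finset.HasAntidiagonal.mem_antidiagonal] at hp ⊢
      exact hp.2
    · intro p hp hp'
      simp only [Finset.mem_filter, Finset.HasAntidiagonal.mem_antidiagonal, Finset.mem_product,
        Finset.mem_range] at hp hp'
      by_cases h : M ≤ p.1
      · exact h1 _ _ h
      · exact h2 _ _ (by by_contra h'; exact hp' ⟨⟨by lia, by lia⟩, hp⟩)
  · intro p hp
    simp only [Finset.mem_product, Finset.mem_range] at hp ⊢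
    lia

end Derivations

/-! ### The derivative of the exponential, and `exp ∘ log = id`. -/

section ExpAd

open Polynomial

set_option linter.unusedSectionVars false

attribute [local instance] LieRing.ofAssociativeRing

variable {𝕜 : Type*} [Field 𝕜] [CharZero 𝕜] {S : Type*} [Ring S] [Algebra 𝕜 S] [Algebra ℚ S]

theorem ad_eq_mulLeft_add_mulRight_neg (Z : S) :
    LieAlgebra.ad 𝕜 S Z = LinearMap.mulLeft 𝕜 Z + LinearMap.mulRight 𝕜 (-Z) := by
  ext y
  simp [LieRing.of_associative_ring_bracket, sub_eq_add_neg]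

theorem ad_pow_eq_zero {Z : S} {n : ℕ} (hZ : Z ^ n = 0) :
    LieAlgebra.ad 𝕜 S Z ^ (2 * n) = 0 := by
  rw [ad_eq_mulLeft_add_mulRight_neg]
  refine (LinearMap.commute_mulLeft_right Z (-Z)).add_pow_eq_zero_of_add_le_succ_of_pow_eq_zero
    (m := n) (n := n) ?_ ?_ (by lia)
  · rw [LinearMap.pow_mulLeft, hZ, LinearMap.mulLeft_zero_eq_zero]
  · rw [LinearMap.pow_mulRight, neg_pow, hZ, mul_zero, LinearMap.mulRight_zero_eq_zero]

/-- `ad Z` is the sum of the commuting operators of left multiplication by `Z` and right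
multiplication by `-Z`, so its exponential factors. -/
theorem exp_ad_apply {Z : S} (hZ : IsNilpotent Z) (y : S) :
    IsNilpotent.exp (LieAlgebra.ad 𝕜 S Z) y = IsNilpotent.exp Z * y * IsNilpotent.exp (-Z) := by
  obtain ⟨n, hn⟩ := hZ
  have hn' : (-Z) ^ n = 0 := by rw [neg_pow, hn, mul_zero]
  have h1 : LinearMap.mulLeft 𝕜 Z ^ n = 0 := by
    rw [LinearMap.pow_mulLeft, hn, LinearMap.mulLeft_zero_eq_zero]
  have h2 : LinearMap.mulRight 𝕜 (-Z) ^ n = 0 := by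
    rw [LinearMap.pow_mulRight, hn', LinearMap.mulRight_zero_eq_zero]
  rw [ad_eq_mulLeft_add_mulRight_neg, IsNilpotent.exp_add_of_commute
    (LinearMap.commute_mulLeft_right Z (-Z)) ⟨n, h1⟩ ⟨n, h2⟩, Module.End.mul_apply,
    IsNilpotent.exp_eq_sum h1, IsNilpotent.exp_eq_sum h2, IsNilpotent.exp_eq_sum hn,
    IsNilpotent.exp_eq_sum hn']
  simp only [LinearMap.pow_mulLeft, LinearMap.pow_mulRight, LinearMap.sum_apply,
    LinearMap.smul_apply, LinearMap.mulLeft_apply, LinearMap.mulRight_apply, Finset.mul_sum,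
    Finset.sum_mul, smul_mul_assoc, mul_smul_comm, Finset.smul_sum, mul_assoc]
  rw [Finset.sum_comm]
  exact Finset.sum_congr rfl fun i _ => Finset.sum_congr rfl fun j _ => smul_comm _ _ _

/-- The classical `δ(e^Z) = ((e^{ad Z} - 1) / ad Z)(δ Z) · e^Z`: in `derivation_pow`, dividing by
`(n + 1)!` splits the binomial coefficient into `1/(k+1)!` and `1/(n-k)!`, which makes the double
sum a product. -/
theorem derivation_exp (δ : S →+ S) (hδ : ∀ a b, δ (a * b) = δ a * b + a * δ b) {Z : S} {M : ℕ}
    (hZ : Z ^ M = 0) (hA : LieAlgebra.ad 𝕜 S Z ^ M = 0) :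
    δ (IsNilpotent.exp Z)
      = aeval (LieAlgebra.ad 𝕜 S Z) (expDiv M) (δ Z) * IsNilpotent.exp Z := by
  have hs : ∀ (q : ℚ) (a : S), δ (q • a) = q • δ a := fun q a => map_rat_smul δ q a
  set f : ℕ → ℕ → S := fun k j => ((k + 1).factorial : ℚ)⁻¹ • (j.factorial : ℚ)⁻¹ •
    ((LieAlgebra.ad 𝕜 S Z ^ k) (δ Z) * Z ^ j) with hf
  have hR : aeval (LieAlgebra.ad 𝕜 S Z) (expDiv M) (δ Z) * IsNilpotent.exp Z
      = ∑ i ∈ Finset.range M, ∑ j ∈ Finset.range M, f i j := by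
    rw [IsNilpotent.exp_eq_sum hZ, expDiv]
    simp only [map_sum, map_mul, aeval_C, map_pow, aeval_X, ← Algebra.smul_def,
      LinearMap.sum_apply, LinearMap.smul_apply, Finset.sum_mul, Finset.mul_sum, smul_mul_assoc,
      mul_smul_comm, Finset.smul_sum, hf]
    rw [Finset.sum_comm]
    exact Finset.sum_congr rfl fun i _ => Finset.sum_congr rfl fun j _ => smul_comm _ _ _
  rw [hR, ← sum_range_antidiagonal_of_vanish M f
    (fun i j h => by simp [hf, pow_eq_zero_of_le h hA])
    (fun i j h => by simp [hf, pow_eq_zero_of_le h hZ]),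
    IsNilpotent.exp_eq_sum (pow_eq_zero_of_le (show M ≤ 2 * M + 1 by lia) hZ), map_sum,
    Finset.sum_range_succ']
  have h1 : δ (((0 : ℕ).factorial : ℚ)⁻¹ • Z ^ 0) = 0 := by
    rw [hs, derivation_pow (𝕜 := 𝕜) δ hδ]; simp
  rw [h1, add_zero]
  refine Finset.sum_congr rfl fun n _ => ?_
  rw [hs, derivation_pow (𝕜 := 𝕜) δ hδ, Finset.Nat.sum_antidiagonal_eq_sum_range_succ f,
    Finset.smul_sum]
  refine Finset.sum_congr rfl fun k hk => ?_
  have hk : k ≤ n := Nat.lt_succ_iff.mp (Finset.mem_range.mp hk)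
  simp only [hf, Nat.add_sub_cancel, ← Nat.cast_smul_eq_nsmul ℚ, smul_smul]
  congr 1
  rw [Nat.cast_choose ℚ (show k + 1 ≤ n + 1 by lia), show n + 1 - (k + 1) = n - k by lia]
  have : ((n + 1).factorial : ℚ) ≠ 0 := by positivity
  field_simp

theorem derivation_exp_of_commute (δ : S →+ S) (hδ : ∀ a b, δ (a * b) = δ a * b + a * δ b) {Z : S}
    (hZ : IsNilpotent Z) (hc : Commute Z (δ Z)) :
    δ (IsNilpotent.exp Z) = δ Z * IsNilpotent.exp Z := by
  obtain ⟨n, hn⟩ := hZ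
  have hA := ad_pow_eq_zero (𝕜 := ℚ) hn
  rw [derivation_exp (𝕜 := ℚ) δ hδ (M := 2 * n + 1) (pow_eq_zero_of_le (by lia) hn)
    (pow_eq_zero_of_le (by lia) hA)]
  congr 1
  have h0 : ∀ i : ℕ, (LieAlgebra.ad ℚ S Z ^ (i + 1)) (δ Z) = 0 := fun i => by
    rw [pow_succ, Module.End.mul_apply, LieAlgebra.ad_apply, LieRing.of_associative_ring_bracket,
      hc.eq, sub_self, map_zero]
  simp only [expDiv, map_sum, map_mul, aeval_C, map_pow, aeval_X, ← Algebra.smul_def,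
      LinearMap.sum_apply, LinearMap.smul_apply]
  rw [Finset.sum_range_succ', Finset.sum_eq_zero fun i _ => by rw [h0, smul_zero]]
  simp

theorem eq_of_derivative_eq {p q : S[X]} (h : derivative p = derivative q)
    (h0 : p.coeff 0 = q.coeff 0) : p = q := by
  ext n
  rcases n with _ | n
  · exact h0
  have := congrArg (fun r => coeff r n) h
  simp only [coeff_derivative] at this
  have hu : IsUnit ((n : S) + 1) := by
    have h1 : IsUnit (algebraMap ℚ S ((n : ℚ) + 1)) :=
      (IsUnit.mk0 _ (by positivity)).map (algebraMap ℚ S)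
    simpa using h1
  exact hu.mul_right_cancel this

theorem commute_aeval_right {a b : S} (h : Commute a b) (q : ℚ[X]) : Commute a (aeval b q) := by
  induction q using Polynomial.induction_on' with
  | add p q hp hq => rw [map_add]; exact hp.add_right hq
  | monomial n c =>
    rw [aeval_monomial]
    exact (Algebra.commute_algebraMap_right c a).mul_right (h.pow_right n)

theorem derivation_aeval (δ : S →+ S) (hδ : ∀ a b, δ (a * b) = δ a * b + a * δ b) {U : S}
    (hc : Commute U (δ U)) (q : ℚ[X]) : δ (aeval U q) = aeval U (derivative q) * δ U := by
  have h1 : δ 1 = 0 := by simpa using hδ 1 1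
  have hpow : ∀ n : ℕ, δ (U ^ n) = (n : ℚ) • (U ^ (n - 1) * δ U) := by
    intro n
    induction n with
    | zero => simp [h1]
    | succ n ih =>
      rw [pow_succ, hδ, ih, smul_mul_assoc, mul_assoc, ← hc.eq, ← mul_assoc]
      rcases n with _ | n
      · simp
      · rw [Nat.add_sub_cancel, Nat.add_sub_cancel, ← pow_succ]
        push_cast
        rw [add_smul (_ + 1 : ℚ), one_smul]
  induction q using Polynomial.induction_on' with
  | add p q hp hq => rw [map_add, map_add, hp, hq, derivative_add, map_add, add_mul]
  | monomial n c =>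
    rw [aeval_monomial, derivative_monomial, aeval_monomial, ← Algebra.smul_def,
      ← Algebra.smul_def, map_rat_smul δ c, hpow, smul_smul, smul_mul_assoc]

theorem map_nilLog {S' : Type*} [Ring S'] [Algebra ℚ S'] (f : S →+* S') (M : ℕ) (u : S) :
    f (nilLog M u) = nilLog M (f u) := by
  rw [nilLog, nilLog, map_mul, aeval_def, aeval_def, hom_eval₂]
  congr 2
  exact RingHom.ext_rat _ _

/-- A differential equation replaces an identity of power series: for `Λ = log (1 + X u)` in `S[X]`,
the product `(1 + X u) e^{-Λ}` has zero derivative and constant term `1`, hence equals `1`. Setting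
`X = 1` gives the claim. -/
theorem exp_nilLog {u : S} {M : ℕ} (hu : u ^ M = 0) :
    IsNilpotent.exp (nilLog M u) = 1 + u := by
  set U : S[X] := X * C u with hU
  have hcU : Commute (X : S[X]) (C u) := commute_X _
  have hUM : U ^ M = 0 := by rw [hU, hcU.mul_pow, ← C_pow, hu, C_0, mul_zero]
  set Λ := nilLog M U with hΛ
  have hnil : Λ ^ M = 0 := nilLog_pow_eq_zero hUM M
  have hΛa : Λ = aeval U (X * logDiv M) := by simp [hΛ, nilLog]
  have hdU : derivative U = C u := by simp [hU]
  have hcd : Commute U (derivative U) := by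
    rw [hdU, hU]; exact (hcU.mul_left (Commute.refl _))
  let δ : S[X] →+ S[X] := (derivative : S[X] →ₗ[S] S[X]).toAddMonoidHom
  have hδ : ∀ a b, δ (a * b) = δ a * b + a * δ b := fun a b => derivative_mul
  have hdaeval : ∀ q : ℚ[X], derivative (aeval U q) = aeval U (derivative q) * derivative U :=
    derivation_aeval δ hδ hcd
  have hdΛ : (1 + U) * derivative Λ = derivative U := by
    rw [hΛa, hdaeval, ← mul_assoc]
    have h1 : (1 + U) * aeval U (derivative (X * logDiv M)) = 1 := by
      have := congrArg (aeval U) (derivative_X_mul_logDiv M)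
      rw [map_mul, map_add, map_one, aeval_X] at this
      rw [this]
      rw [map_sub, map_one, map_pow, map_neg, aeval_X, neg_pow, hUM, mul_zero, sub_zero]
    rw [h1, one_mul]
  have hcU' : Commute U Λ := by
    rw [hΛa]; exact commute_aeval_right (Commute.refl U) _
  have hcΛd : Commute Λ (derivative Λ) := by
    rw [hΛa, hdaeval]
    exact (commute_aeval_right (commute_aeval_right (Commute.refl U) _).symm _).mul_right
      (commute_aeval_right hcd.symm _).symm
  have hneg : IsNilpotent (-Λ) := IsNilpotent.neg ⟨M, hnil⟩
  have hdneg : derivative (IsNilpotent.exp (-Λ)) = -(derivative Λ) * IsNilpotent.exp (-Λ) := by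
    have := derivation_exp_of_commute δ hδ hneg (by
      show Commute (-Λ) (derivative (-Λ))
      rw [derivative_neg]
      exact (hcΛd.neg_left).neg_right)
    rwa [show δ (-Λ) = -derivative Λ from derivative_neg _] at this
  have hcexp : Commute (1 + U) (IsNilpotent.exp (-Λ)) := by
    refine (Commute.one_left _).add_left ?_
    have hM : (-Λ) ^ M = 0 := by rw [neg_pow, hnil, mul_zero]
    rw [IsNilpotent.exp_eq_sum hM]
    exact Commute.sum_right _ _ _ fun i _ => ((hcU'.neg_right).pow_right i).smul_right _
  have hQ : (1 + U) * IsNilpotent.exp (-Λ) = 1 := by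
    refine eq_of_derivative_eq ?_ ?_
    · rw [derivative_mul, hdneg, derivative_one, derivative_add, derivative_one, zero_add,
        neg_mul, mul_neg, ← mul_assoc, hdΛ, add_neg_cancel]
    · have h0 := congrArg (constantCoeff : S[X] →+* S) (rfl :
        (1 + U) * IsNilpotent.exp (-Λ) = (1 + U) * IsNilpotent.exp (-Λ))
      have hU0 : (constantCoeff : S[X] →+* S) U = 0 := by simp [hU]
      have hΛ0 : (constantCoeff : S[X] →+* S) Λ = 0 := by
        rw [hΛ, nilLog, map_mul, hU0, zero_mul]
      show constantCoeff ((1 + U) * IsNilpotent.exp (-Λ)) = constantCoeff 1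
      rw [map_mul, IsNilpotent.map_exp hneg, map_add, hU0, map_neg, hΛ0]
      simp
  have hE : IsNilpotent.exp Λ = 1 + U := by
    have := IsNilpotent.exp_neg_mul_exp_self (⟨M, hnil⟩ : IsNilpotent Λ)
    calc IsNilpotent.exp Λ = (1 + U) * IsNilpotent.exp (-Λ) * IsNilpotent.exp Λ := by
          rw [hQ, one_mul]
      _ = 1 + U := by rw [mul_assoc, this, mul_one]
  -- Over a noncommutative `S`, evaluation is multiplicative here because the point `1` is central.
  let ev : S[X] →+* S := eval₂RingHom' (RingHom.id S) 1 (fun a => Commute.one_right _)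
  have hevU : ev U = u := by simp [ev, hU]
  have := congrArg ev hE
  rw [IsNilpotent.map_exp ⟨M, hnil⟩, map_add, map_one, hevU] at this
  rw [← this]
  congr 1
  rw [hΛ, map_nilLog, hevU]

end ExpAd

/-! ### Dynkin's formula in an associative algebra. -/

section Dynkin

open Polynomial

set_option linter.unusedSectionVars false

theorem sum_pow_eq_sum_piFinset {ι A : Type*} [DecidableEq ι] [Semiring A] (s : Finset ι)
    (f : ι → A) (k : ℕ) :
    (∑ i ∈ s, f i) ^ k
      = ∑ p ∈ Fintype.piFinset (fun _ : Fin k => s), (List.ofFn fun i => f (p i)).prod := by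
  induction k with
  | zero => simp
  | succ k ih =>
    rw [pow_succ', ih, Finset.sum_mul_sum, ← Finset.sum_product']
    refine Finset.sum_nbij' (fun q => (Fin.cons q.1 q.2 : Fin (k + 1) → ι))
      (fun p => (p 0, Fin.tail p)) ?_ ?_ ?_ ?_ ?_
    · rintro ⟨i, q⟩ h
      simp only [Finset.mem_product, Fintype.mem_piFinset] at h ⊢
      exact fun j => Fin.cases h.1 h.2 j
    · intro p h
      simp only [Finset.mem_product, Fintype.mem_piFinset] at h ⊢
      exact ⟨h 0, fun j => h j.succ⟩
    · rintro ⟨i, q⟩ -; simp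
    · intro p _; simp
    · rintro ⟨i, q⟩ -; simp [List.ofFn_succ]

theorem prod_ofFn_smul {𝕜 A : Type*} [CommSemiring 𝕜] [Semiring A] [Algebra 𝕜 A] {k : ℕ}
    (c : Fin k → 𝕜) (g : Fin k → A) :
    (List.ofFn fun i => c i • g i).prod = (∏ i, c i) • (List.ofFn g).prod := by
  induction k with
  | zero => simp
  | succ k ih => simp [List.ofFn_succ, ih, Fin.prod_univ_succ, smul_smul, mul_comm]

/-- The monomial `(ad x)^{p₁} (ad y)^{q₁} ⋯ (ad x)^{p_k} (ad y)^{q_k}`. -/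
def adWord (𝕜 : Type v) [CommRing 𝕜] {𝔤 : Type u} [LieRing 𝔤] [LieAlgebra 𝕜 𝔤] (x y : 𝔤)
    (l : List (ℕ × ℕ)) : Module.End 𝕜 𝔤 :=
  (l.map fun q => LieAlgebra.ad 𝕜 𝔤 x ^ q.1 * LieAlgebra.ad 𝕜 𝔤 y ^ q.2).prod

theorem adWord_ofFn (𝕜 : Type v) [CommRing 𝕜] {𝔤 : Type u} [LieRing 𝔤] [LieAlgebra 𝕜 𝔤] (x y : 𝔤)
    {k : ℕ} (p : Fin k → ℕ × ℕ) :
    (List.ofFn fun i : Fin k =>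
      LieAlgebra.ad 𝕜 𝔤 x ^ (p i).1 * LieAlgebra.ad 𝕜 𝔤 y ^ (p i).2).prod
      = adWord 𝕜 x y (List.ofFn p) := by
  rw [adWord, List.map_ofFn]; rfl

attribute [local instance] LieRing.ofAssociativeRing

section AdPolynomial

variable {𝕜 : Type*} [Field 𝕜] {R : Type*} [Ring R] [Algebra 𝕜 R]

theorem ad_C_monomial (a c : R) (r : ℕ) :
    LieAlgebra.ad 𝕜 R[X] (C a) (monomial r c) = monomial r (LieAlgebra.ad 𝕜 R a c) := by
  simp [LieRing.of_associative_ring_bracket, C_mul_monomial, monomial_mul_C]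

theorem ad_X_mul_C_monomial (b c : R) (r : ℕ) :
    LieAlgebra.ad 𝕜 R[X] (X * C b) (monomial r c) = monomial (r + 1) (LieAlgebra.ad 𝕜 R b c) := by
  rw [LieAlgebra.ad_apply, LieAlgebra.ad_apply, LieRing.of_associative_ring_bracket,
    LieRing.of_associative_ring_bracket, X_mul_C, C_mul_X_eq_monomial, monomial_mul_monomial,
    monomial_mul_monomial, map_sub, add_comm 1 r]

theorem ad_C_pow_monomial (a c : R) (r n : ℕ) :
    (LieAlgebra.ad 𝕜 R[X] (C a) ^ n) (monomial r c)
      = monomial r ((LieAlgebra.ad 𝕜 R a ^ n) c) := by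
  induction n with
  | zero => simp
  | succ n ih => rw [pow_succ', pow_succ', Module.End.mul_apply, ih, ad_C_monomial]; rfl

theorem ad_X_mul_C_pow_monomial (b c : R) (r n : ℕ) :
    (LieAlgebra.ad 𝕜 R[X] (X * C b) ^ n) (monomial r c)
      = monomial (r + n) ((LieAlgebra.ad 𝕜 R b ^ n) c) := by
  induction n with
  | zero => simp
  | succ n ih => rw [pow_succ', pow_succ', Module.End.mul_apply, ih, ad_X_mul_C_monomial]; rfl

/-- The power of `X` counts the letters `b`. Integrating that power later gives Dynkin's denominator
`q₁ + ⋯ + q_k + 1`. -/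
theorem adWord_monomial (a b c : R) (r : ℕ) (l : List (ℕ × ℕ)) :
    adWord 𝕜 (C a) (X * C b) l (monomial r c)
      = monomial (r + (l.map Prod.snd).sum) (adWord 𝕜 a b l c) := by
  induction l with
  | nil => simp [adWord]
  | cons q l ih =>
    simp only [adWord, List.map_cons, List.prod_cons, Module.End.mul_apply, List.sum_cons]
      at ih ⊢
    rw [ih, ad_X_mul_C_pow_monomial, ad_C_pow_monomial, add_assoc, add_comm q.2]

end AdPolynomial

variable {𝕜 : Type*} [RCLike 𝕜] {R : Type*} [Ring R] [Algebra 𝕜 R] [Algebra ℚ R]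

/-- `exp (ad a) * exp (ad b) - 1`, written as a finite sum of monomials. -/
theorem exp_mul_exp_eq_one_add_sum {A : Type*} [Ring A] [Algebra 𝕜 A] [Algebra ℚ A] {α β : A}
    {M : ℕ} (hM : 1 ≤ M) (hα : α ^ M = 0) (hβ : β ^ M = 0) :
    IsNilpotent.exp α * IsNilpotent.exp β
      = 1 + ∑ p ∈ (Finset.range M ×ˢ Finset.range M).erase ((0, 0) : ℕ × ℕ),
        (((p.1.factorial : 𝕜) * (p.2.factorial : 𝕜))⁻¹) • (α ^ p.1 * β ^ p.2) := by
  have h0 : ((0, 0) : ℕ × ℕ) ∈ Finset.range M ×ˢ Finset.range M := by simp; lia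
  have h1 : (1 : A) = (((((0, 0) : ℕ × ℕ).1.factorial : 𝕜) *
      (((0, 0) : ℕ × ℕ).2.factorial : 𝕜))⁻¹) • (α ^ ((0, 0) : ℕ × ℕ).1 *
      β ^ ((0, 0) : ℕ × ℕ).2) := by simp
  rw [h1, Finset.add_sum_erase _ (fun p : ℕ × ℕ =>
      (((p.1.factorial : 𝕜) * (p.2.factorial : 𝕜))⁻¹) • (α ^ p.1 * β ^ p.2)) h0,
    IsNilpotent.exp_eq_sum hα, IsNilpotent.exp_eq_sum hβ,
    Finset.sum_mul_sum, ← Finset.sum_product']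
  refine Finset.sum_congr rfl fun p _ => ?_
  rw [smul_mul_assoc, mul_smul_comm, smul_smul, ← Rat.cast_smul_eq_qsmul 𝕜]
  push_cast
  rw [mul_inv]

/-- `Z = log (e^a e^{Xb})` in `R[X]` satisfies a differential equation whose right side is explicit;
its antiderivative with constant term `a` is the Dynkin sum with weights `X^(q₁+⋯+q_k+1)`.
Nilpotency of `e^a e^{Xb} - 1` is a separate hypothesis because `a` and `b` need not commute. The
bound on `M` makes `(ad Z)^(M-1)` vanish. -/
theorem exp_bch {a b : R} {n M : ℕ} (ha : a ^ n = 0) (hb : b ^ n = 0)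
    (hW : (IsNilpotent.exp (C a) * IsNilpotent.exp (X * C b) - 1) ^ n = 0)
    (hM : 2 * n + 1 ≤ M) :
    IsNilpotent.exp (bch 𝕜 M a b) = IsNilpotent.exp a * IsNilpotent.exp b ∧
      bch 𝕜 M a b ^ n = 0 := by
  obtain ⟨K, rfl⟩ : ∃ K, M = K + 1 := ⟨M - 1, by lia⟩
  set α : R[X] := C a with hα
  set β : R[X] := X * C b with hβ
  have hαn : α ^ n = 0 := by rw [hα, ← C_pow, ha, C_0]
  have hcX : Commute (X : R[X]) (C b) := commute_X _
  have hβn : β ^ n = 0 := by rw [hβ, hcX.mul_pow, ← C_pow, hb, C_0, mul_zero]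
  set W := IsNilpotent.exp α * IsNilpotent.exp β with hWdef
  set Z := nilLog (n + 1) (W - 1) with hZ
  have hZn : Z ^ n = 0 := nilLog_pow_eq_zero hW _
  have hZnil : IsNilpotent Z := ⟨n, hZn⟩
  have hexpZ : IsNilpotent.exp Z = W := by
    rw [hZ, exp_nilLog (pow_eq_zero_of_le n.le_succ hW)]; abel
  let δ : R[X] →+ R[X] := (derivative : R[X] →ₗ[R] R[X]).toAddMonoidHom
  have hδ : ∀ p q, δ (p * q) = δ p * q + p * δ q := fun p q => derivative_mul
  have hdα : δ (IsNilpotent.exp α) = 0 := by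
    show derivative (IsNilpotent.exp α) = 0
    rw [hα, ← IsNilpotent.map_exp ⟨n, ha⟩ (C : R →+* R[X]), derivative_C]
  have hdβ : δ β = C b := by show derivative β = C b; simp [hβ]
  have hcβ : Commute β (C b) := hcX.mul_left (Commute.refl _)
  have hdβ' : δ (IsNilpotent.exp β) = IsNilpotent.exp β * C b := by
    rw [derivation_exp_of_commute δ hδ ⟨n, hβn⟩ (by rw [hdβ]; exact hcβ), hdβ,
      IsNilpotent.exp_eq_sum hβn]
    exact Commute.eq (Commute.sum_right _ _ _ fun i _ => ((hcβ.symm).pow_right i).smul_right _)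
  have hdW : δ W = W * C b := by rw [hWdef, hδ, hdα, hdβ', zero_mul, zero_add, mul_assoc]
  set A := LieAlgebra.ad 𝕜 R[X] Z with hA
  have hAK : A ^ K = 0 := pow_eq_zero_of_le (by lia) (ad_pow_eq_zero hZn)
  have hinv : IsNilpotent.exp (-Z) * W = 1 := by
    rw [← hexpZ, IsNilpotent.exp_neg_mul_exp_self hZnil]
  have hinv' : W * IsNilpotent.exp (-Z) = 1 := by
    rw [← hexpZ, IsNilpotent.exp_mul_exp_neg_self hZnil]
  -- Compare the two expressions for `δ (e^Z)`: `derivation_exp` on one side, `W b = (e^{ad Z} b) W`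
  -- on the other; then cancel `W`.
  have h1 : aeval A (expDiv K) (δ Z) = IsNilpotent.exp A (C b) := by
    have h2 := derivation_exp (𝕜 := 𝕜) δ hδ (pow_eq_zero_of_le (show n ≤ K by lia) hZn) hAK
    rw [hexpZ, hdW] at h2
    rw [hA, exp_ad_apply hZnil, hexpZ, h2, mul_assoc, hinv', mul_one]
  -- `log (1 + u) / u` at `u = e^A - 1` inverts `(e^A - 1) / A`.
  have h3 : δ Z = (aeval (IsNilpotent.exp A - 1) (logDiv (K + 1)) * IsNilpotent.exp A) (C b) := by
    rw [Module.End.mul_apply, ← h1, ← Module.End.mul_apply, aeval_logDiv_mul_aeval_expDiv hAK,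
      Module.End.one_apply]
  have hadα : LieAlgebra.ad 𝕜 R[X] α ^ (K + 1) = 0 :=
    pow_eq_zero_of_le (by lia) (ad_pow_eq_zero hαn)
  have hadβ : LieAlgebra.ad 𝕜 R[X] β ^ (K + 1) = 0 :=
    pow_eq_zero_of_le (by lia) (ad_pow_eq_zero hβn)
  have hnegZ : IsNilpotent.exp (-Z) = IsNilpotent.exp (-β) * IsNilpotent.exp (-α) := by
    have h : W * (IsNilpotent.exp (-β) * IsNilpotent.exp (-α)) = 1 := by
      rw [hWdef, mul_assoc, ← mul_assoc (IsNilpotent.exp β),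
        IsNilpotent.exp_mul_exp_neg_self ⟨n, hβn⟩, one_mul,
        IsNilpotent.exp_mul_exp_neg_self ⟨n, hαn⟩]
    exact left_inv_eq_right_inv hinv h
  have h4 : IsNilpotent.exp A = IsNilpotent.exp (LieAlgebra.ad 𝕜 R[X] α) *
      IsNilpotent.exp (LieAlgebra.ad 𝕜 R[X] β) := by
    ext1 y
    rw [Module.End.mul_apply, exp_ad_apply ⟨n, hβn⟩, exp_ad_apply ⟨n, hαn⟩, hA,
      exp_ad_apply hZnil, hexpZ, hnegZ, hWdef]
    simp only [mul_assoc]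
  have h5 : IsNilpotent.exp A (C b)
      = ∑ m ∈ Finset.range (K + 1), ((m.factorial : 𝕜)⁻¹) •
        (LieAlgebra.ad 𝕜 R[X] α ^ m) (C b) := by
    -- The factor `e^{ad β}` fixes `b`, which is why Dynkin's formula ends in `(ad x)^m y` without a
    -- last power of `ad y`.
    have : IsNilpotent.exp (LieAlgebra.ad 𝕜 R[X] β) (C b) = C b := by
      rw [IsNilpotent.exp_eq_sum hadβ, Finset.sum_range_succ']
      have h0 : ∀ i : ℕ, (LieAlgebra.ad 𝕜 R[X] β ^ (i + 1)) (C b) = 0 := fun i => by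
        rw [pow_succ, Module.End.mul_apply, LieAlgebra.ad_apply,
          LieRing.of_associative_ring_bracket, hcβ.eq, sub_self, map_zero]
      simp only [LinearMap.add_apply, LinearMap.sum_apply, LinearMap.smul_apply, h0]
      simp
    rw [h4, Module.End.mul_apply, this, IsNilpotent.exp_eq_sum hadα, LinearMap.sum_apply]
    refine Finset.sum_congr rfl fun m _ => ?_
    rw [LinearMap.smul_apply, ← Rat.cast_smul_eq_qsmul 𝕜]
    push_cast
    rfl
  set c : (k : ℕ) → (Fin k → ℕ × ℕ) → ℕ → 𝕜 := fun k p m =>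
    (-1 : 𝕜) ^ k / ((k + 1) * ((∑ i, ((p i).2 : 𝕜)) + 1) *
      (∏ i, (((p i).1.factorial : 𝕜) * ((p i).2.factorial : 𝕜))) * (m.factorial : 𝕜)) with hc
  set w : (k : ℕ) → (Fin k → ℕ × ℕ) → ℕ → R := fun k p m =>
    (adWord 𝕜 a b (List.ofFn p) * LieAlgebra.ad 𝕜 R a ^ m) b with hw
  set T := (Finset.range (K + 1) ×ˢ Finset.range (K + 1)).erase ((0, 0) : ℕ × ℕ) with hT
  -- The factor `∑ qᵢ + 1` cancels the one in the denominator of `c`; it returns when the monomial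
  -- is integrated.
  have h6 : δ Z = ∑ k ∈ Finset.range (K + 1), ∑ p ∈ Fintype.piFinset (fun _ : Fin k => T),
      ∑ m ∈ Finset.range (K + 1), monomial (∑ i, (p i).2)
        (((((∑ i, (p i).2 : ℕ) : 𝕜) + 1) * c k p m) • w k p m) := by
    rw [h3, Module.End.mul_apply, h5, h4,
      exp_mul_exp_eq_one_add_sum (𝕜 := 𝕜) (by lia) hadα hadβ, add_sub_cancel_left, logDiv,
      map_sum (aeval _), LinearMap.sum_apply]
    refine Finset.sum_congr rfl fun k _ => ?_
    rw [map_mul, aeval_C, ← Algebra.smul_def, map_pow, aeval_X, sum_pow_eq_sum_piFinset,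
      Finset.smul_sum, LinearMap.sum_apply]
    refine Finset.sum_congr rfl fun p _ => ?_
    rw [map_sum]
    refine Finset.sum_congr rfl fun m _ => ?_
    rw [prod_ofFn_smul, adWord_ofFn, LinearMap.smul_apply, LinearMap.smul_apply, map_smul,
      ← monomial_zero_left, hα, ad_C_pow_monomial, hβ, adWord_monomial,
      ← Rat.cast_smul_eq_qsmul 𝕜, smul_smul, smul_smul, smul_monomial, zero_add, List.map_ofFn,
      List.sum_ofFn]
    congr 1
    simp only [hw, Module.End.mul_apply]
    congr 1
    have hne : ((∑ i, ((p i).2 : 𝕜)) + 1) ≠ 0 := by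
      have : (((∑ i, (p i).2) + 1 : ℕ) : 𝕜) ≠ 0 := Nat.cast_ne_zero.mpr (by lia)
      push_cast at this
      exact this
    simp only [hc]
    rw [Finset.prod_inv_distrib]
    push_cast
    have hk : (k + 1 : 𝕜) ≠ 0 := by exact_mod_cast (Nat.cast_ne_zero (R := 𝕜)).mpr k.succ_ne_zero
    have hprod : (∏ i, (((p i).1.factorial : 𝕜) * ((p i).2.factorial : 𝕜))) ≠ 0 :=
      Finset.prod_ne_zero_iff.mpr fun i _ => by
        simp [Nat.factorial_ne_zero]
    have hm : (m.factorial : 𝕜) ≠ 0 := by simp [Nat.factorial_ne_zero]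
    field_simp
  set B : R[X] := C a + ∑ k ∈ Finset.range (K + 1),
    ∑ p ∈ Fintype.piFinset (fun _ : Fin k => T), ∑ m ∈ Finset.range (K + 1),
      monomial ((∑ i, (p i).2) + 1) (c k p m • w k p m) with hB
  have hBZ : Z = B := by
    refine eq_of_derivative_eq ?_ ?_
    · rw [show derivative Z = δ Z from rfl, h6, hB, derivative_add, derivative_C, zero_add]
      simp only [derivative_sum, derivative_monomial]
      refine Finset.sum_congr rfl fun k _ => Finset.sum_congr rfl fun p _ =>
        Finset.sum_congr rfl fun m _ => ?_
      rw [Nat.add_sub_cancel]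
      congr 1
      rw [mul_smul, ← nsmul_eq_mul', ← Nat.cast_smul_eq_nsmul 𝕜]
      push_cast
      rfl
    · have hZ0 : constantCoeff Z = a := by
        rw [hZ, map_nilLog, map_sub, hWdef, map_mul, IsNilpotent.map_exp ⟨n, hαn⟩,
          IsNilpotent.map_exp ⟨n, hβn⟩]
        have e1 : constantCoeff α = a := by simp [hα]
        have e2 : constantCoeff β = 0 := by simp [hβ]
        rw [e1, e2, IsNilpotent.exp_zero, mul_one, map_one, nilLog_exp ha]
      rw [← constantCoeff_apply, hZ0, hB]
      simp [coeff_monomial]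
  let ev : R[X] →+* R := eval₂RingHom' (RingHom.id R) 1 (fun a => Commute.one_right _)
  have hevB : ev B = bch 𝕜 (K + 1) a b := by
    rw [hB, bch]
    simp only [map_add, map_sum, adWord_ofFn]
    simp [ev, hc, hw, hT]
  constructor
  · rw [← hevB, ← hBZ, ← IsNilpotent.map_exp hZnil, hexpZ, hWdef, map_mul,
      IsNilpotent.map_exp ⟨n, hαn⟩, IsNilpotent.map_exp ⟨n, hβn⟩]
    simp [ev, hα, hβ]
  · rw [← hevB, ← hBZ, ← map_pow, hZn, map_zero]

end Dynkin

/-! ### Functoriality of `bch`, and filtrations that cut the series off. -/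

section BCHAlgebra

variable {𝕜 : Type*} [RCLike 𝕜] {𝔤 : Type*} [LieRing 𝔤] [LieAlgebra 𝕜 𝔤]

/-- The rational coefficient of an iterated bracket in the Baker-Campbell-Hausdorff series. -/
noncomputable def bchCoeff (𝕜 : Type*) [RCLike 𝕜] {k : ℕ} (p : Fin k → ℕ × ℕ) (m : ℕ) : 𝕜 :=
  (-1 : 𝕜) ^ k / ((k + 1) * ((∑ i, ((p i).2 : 𝕜)) + 1) *
    (∏ i, (((p i).1.factorial : 𝕜) * ((p i).2.factorial : 𝕜))) * (m.factorial : 𝕜))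

/-- The pairs of exponents that occur in the Baker-Campbell-Hausdorff series. -/
def bchExponents (N : ℕ) : Finset (ℕ × ℕ) :=
  (Finset.range N ×ˢ Finset.range N).erase ((0, 0) : ℕ × ℕ)

theorem bch_eq_sum (N : ℕ) (x y : 𝔤) : bch 𝕜 N x y = x + ∑ k ∈ Finset.range N,
    ∑ p ∈ Fintype.piFinset (fun _ : Fin k => bchExponents N), ∑ m ∈ Finset.range N,
      bchCoeff 𝕜 p m • adWord 𝕜 x y (List.ofFn p) ((LieAlgebra.ad 𝕜 𝔤 x ^ m) y) := by
  rw [bch]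
  simp only [adWord_ofFn, Module.End.mul_apply]
  rfl

section Functoriality

variable {𝔥 : Type*} [LieRing 𝔥] [LieAlgebra 𝕜 𝔥] (f : 𝔤 →ₗ⁅𝕜⁆ 𝔥)

theorem map_ad_pow_apply (x y : 𝔤) (n : ℕ) :
    f ((LieAlgebra.ad 𝕜 𝔤 x ^ n) y) = (LieAlgebra.ad 𝕜 𝔥 (f x) ^ n) (f y) := by
  induction n with
  | zero => simp
  | succ n ih =>
    rw [pow_succ', pow_succ', Module.End.mul_apply, Module.End.mul_apply, ← ih,
      LieAlgebra.ad_apply, LieAlgebra.ad_apply, LieHom.map_lie]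

theorem map_adWord_apply (x y z : 𝔤) (l : List (ℕ × ℕ)) :
    f (adWord 𝕜 x y l z) = adWord 𝕜 (f x) (f y) l (f z) := by
  induction l with
  | nil => simp [adWord]
  | cons q l ih =>
    simp only [adWord, List.map_cons, List.prod_cons, Module.End.mul_apply] at ih ⊢
    rw [map_ad_pow_apply, map_ad_pow_apply, ih]

theorem map_bch (N : ℕ) (x y : 𝔤) : f (bch 𝕜 N x y) = bch 𝕜 N (f x) (f y) := by
  simp only [bch_eq_sum, map_add, map_sum, map_smul, map_adWord_apply, map_ad_pow_apply]

end Functoriality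


/-- In every term other than `k = m = 0` the innermost nontrivial operator applied to `y` produces
`⁅x, y⁆` or `⁅y, y⁆`. -/
theorem bch_of_lie_eq_zero {N : ℕ} (hN : 1 ≤ N) {x y : 𝔤} (h : ⁅x, y⁆ = 0) :
    bch 𝕜 N x y = x + y := by
  have hx : ∀ m, m ≠ 0 → (LieAlgebra.ad 𝕜 𝔤 x ^ m) y = 0 := fun m hm => by
    obtain ⟨m, rfl⟩ := Nat.exists_eq_succ_of_ne_zero hm
    rw [pow_succ, Module.End.mul_apply, LieAlgebra.ad_apply, h, map_zero]
  have hy : ∀ m, m ≠ 0 → (LieAlgebra.ad 𝕜 𝔤 y ^ m) y = 0 := fun m hm => by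
    obtain ⟨m, rfl⟩ := Nat.exists_eq_succ_of_ne_zero hm
    rw [pow_succ, Module.End.mul_apply, LieAlgebra.ad_apply, lie_self, map_zero]
  have hw : ∀ l : List (ℕ × ℕ), l ≠ [] → (∀ q ∈ l, q ≠ (0, 0)) → adWord 𝕜 x y l y = 0 := by
    intro l hl hq
    induction l with
    | nil => exact absurd rfl hl
    | cons q l ih =>
      simp only [adWord, List.map_cons, List.prod_cons, Module.End.mul_apply] at ih ⊢
      by_cases hl' : l = []
      · subst hl'
        simp only [List.map_nil, List.prod_nil, Module.End.one_apply]
        by_cases hq2 : q.2 = 0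
        · rw [hq2, pow_zero, Module.End.one_apply]
          exact hx _ fun hq1 => hq q (by simp) (Prod.ext hq1 hq2)
        · rw [hy _ hq2, map_zero]
      · rw [ih hl' fun q' hq' => hq q' (by simp [hq']), map_zero, map_zero]
  rw [bch_eq_sum, Finset.sum_eq_single 0]
  · rw [Fintype.piFinset_of_isEmpty, Finset.univ_unique, Finset.sum_singleton,
      Finset.sum_eq_single 0]
    · simp [bchCoeff, adWord]
    · intro m _ hm
      rw [hx m hm, map_zero, smul_zero]
    · intro h0; exact absurd (Finset.mem_range.mpr hN) h0
  · intro k _ hk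
    refine Finset.sum_eq_zero fun p hp => Finset.sum_eq_zero fun m _ => ?_
    by_cases hm : m = 0
    · subst hm
      rw [pow_zero, Module.End.one_apply, hw _ (by simpa using hk), smul_zero]
      intro q hq
      obtain ⟨i, rfl⟩ := (List.mem_ofFn' _ _).mp hq
      exact Finset.ne_of_mem_erase (Fintype.mem_piFinset.mp hp i)
    · rw [hx m hm, map_zero, smul_zero]
  · intro h0; exact absurd (Finset.mem_range.mpr hN) h0

/-- A decreasing filtration of a Lie algebra that is raised by all inner derivations and
terminates after `N` steps. -/
structure LieFiltration (𝕜 : Type*) [CommRing 𝕜] (𝔤 : Type*) [LieRing 𝔤] [LieAlgebra 𝕜 𝔤]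
    (N : ℕ) where
  /-- The terms of the filtration. -/
  toFun : ℕ → Submodule 𝕜 𝔤
  antitone : Antitone toFun
  zero_eq_top : toFun 0 = ⊤
  eq_bot : toFun N = ⊥
  lie_mem : ∀ k (x m : 𝔤), m ∈ toFun k → ⁅x, m⁆ ∈ toFun (k + 1)

namespace LieFiltration

variable {N : ℕ}

/-- The lower central series of a nilpotent Lie algebra. -/
def ofLowerCentralSeries (h : LieModule.lowerCentralSeries 𝕜 𝔤 𝔤 N = ⊥) :
    LieFiltration 𝕜 𝔤 N where
  toFun k := (LieModule.lowerCentralSeries 𝕜 𝔤 𝔤 k).toSubmodule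
  antitone _ _ hij := LieModule.antitone_lowerCentralSeries 𝕜 𝔤 𝔤 hij
  zero_eq_top := by simp
  eq_bot := by simp [h]
  lie_mem k x m hm := by
    rw [LieModule.lowerCentralSeries_succ]
    exact LieSubmodule.lie_mem_lie (LieSubmodule.mem_top x) hm

theorem ad_pow_mem (V : LieFiltration 𝕜 𝔤 N) (x : 𝔤) {m : 𝔤} {k : ℕ} (hm : m ∈ V.toFun k) (n : ℕ) :
    (LieAlgebra.ad 𝕜 𝔤 x ^ n) m ∈ V.toFun (k + n) := by
  induction n with
  | zero => simpa using hm
  | succ n ih => rw [pow_succ', Module.End.mul_apply]; exact V.lie_mem _ _ _ ih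

theorem adWord_mem (V : LieFiltration 𝕜 𝔤 N) (x y : 𝔤) {z : 𝔤} {k : ℕ} (hz : z ∈ V.toFun k)
    (l : List (ℕ × ℕ)) :
    adWord 𝕜 x y l z ∈ V.toFun (k + (l.map fun q => q.1 + q.2).sum) := by
  induction l with
  | nil => simpa [adWord] using hz
  | cons q l ih =>
    simp only [adWord, List.map_cons, List.prod_cons, Module.End.mul_apply, List.sum_cons] at ih ⊢
    have := V.ad_pow_mem x (V.ad_pow_mem y ih q.2) q.1
    convert this using 2
    ring

theorem eq_zero_of_mem (V : LieFiltration 𝕜 𝔤 N) {z : 𝔤} {k : ℕ} (hz : z ∈ V.toFun k)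
    (hk : N ≤ k) : z = 0 := by
  have := V.antitone hk hz
  rwa [V.eq_bot, Submodule.mem_bot] at this

theorem adWord_ofFn_apply_eq_zero (V : LieFiltration 𝕜 𝔤 N) (x y z : 𝔤) {k : ℕ} (p : Fin k → ℕ × ℕ)
    (m : ℕ)
    (h : N ≤ m + ∑ i, ((p i).1 + (p i).2)) :
    adWord 𝕜 x y (List.ofFn p) ((LieAlgebra.ad 𝕜 𝔤 x ^ m) z) = 0 := by
  have hz : z ∈ V.toFun 0 := by rw [V.zero_eq_top]; trivial
  refine V.eq_zero_of_mem (V.adWord_mem x y (V.ad_pow_mem x hz m) _) ?_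
  rw [List.map_ofFn, List.sum_ofFn, zero_add]
  exact h

/-- A term with at least `N` operators vanishes, and an index `k`, `m`, `pᵢ` or `qᵢ` that is at
least `N` forces that many, since no `(pᵢ, qᵢ)` is `(0, 0)`. This reconciles the truncation at `N`
with the longer one required by `exp_bch`. -/
theorem bch_eq_of_le (V : LieFiltration 𝕜 𝔤 N) {M : ℕ} (hM : N ≤ M) (x y : 𝔤) :
    bch 𝕜 M x y = bch 𝕜 N x y := by
  have hsub : bchExponents N ⊆ bchExponents M := by
    intro q hq
    simp only [bchExponents, Finset.mem_erase, Finset.mem_product, Finset.mem_range] at hq ⊢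
    exact ⟨hq.1, by lia, by lia⟩
  have hle : ∀ {k : ℕ} (p : Fin k → ℕ × ℕ) (i : Fin k),
      (p i).1 + (p i).2 ≤ ∑ i, ((p i).1 + (p i).2) := fun p i =>
    Finset.single_le_sum (f := fun i => (p i).1 + (p i).2) (fun _ _ => Nat.zero_le _)
      (Finset.mem_univ i)
  rw [bch_eq_sum, bch_eq_sum]
  congr 1
  have h1 : ∀ k ∈ Finset.range M,
      (∑ p ∈ Fintype.piFinset (fun _ : Fin k => bchExponents M), ∑ m ∈ Finset.range M,
        bchCoeff 𝕜 p m • adWord 𝕜 x y (List.ofFn p) ((LieAlgebra.ad 𝕜 𝔤 x ^ m) y))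
      = ∑ p ∈ Fintype.piFinset (fun _ : Fin k => bchExponents N), ∑ m ∈ Finset.range N,
        bchCoeff 𝕜 p m • adWord 𝕜 x y (List.ofFn p) ((LieAlgebra.ad 𝕜 𝔤 x ^ m) y) := by
    intro k _
    rw [← Finset.sum_subset (Fintype.piFinset_subset _ _ fun _ => hsub)]
    · refine Finset.sum_congr rfl fun p _ => ?_
      refine (Finset.sum_subset (Finset.range_mono hM) fun m _ hm => ?_).symm
      rw [V.adWord_ofFn_apply_eq_zero, smul_zero]
      simp only [Finset.mem_range] at hm
      lia
    · intro p hp hp'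
      simp only [Fintype.mem_piFinset, not_forall] at hp hp'
      obtain ⟨i, hi⟩ := hp'
      refine Finset.sum_eq_zero fun m _ => ?_
      rw [V.adWord_ofFn_apply_eq_zero, smul_zero]
      have := hp i
      have := hle p i
      simp only [bchExponents, Finset.mem_erase, Finset.mem_product, Finset.mem_range, not_and,
        ne_eq] at hi hp
      have := hi (hp i).1
      lia
  rw [Finset.sum_congr rfl h1]
  refine (Finset.sum_subset (Finset.range_mono hM) fun k _ hk => ?_).symm
  refine Finset.sum_eq_zero fun p hp => Finset.sum_eq_zero fun m _ => ?_
  rw [V.adWord_ofFn_apply_eq_zero, smul_zero]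
  have : ∑ _i : Fin k, 1 ≤ ∑ i, ((p i).1 + (p i).2) := by
    refine Finset.sum_le_sum fun i _ => ?_
    have := Finset.ne_of_mem_erase (Fintype.mem_piFinset.mp hp i)
    by_contra h
    exact this (Prod.ext (by simp; lia) (by simp; lia))
  simp only [Finset.mem_range] at hk
  simp at this
  lia

end LieFiltration

end BCHAlgebra

/-! ### A representation that detects the image of a derivation. -/

section DerivationRepresentation

open Polynomial

attribute [local instance] LieRing.ofAssociativeRing

variable {𝕜 : Type*} [RCLike 𝕜] {𝔥 : Type*} [LieRing 𝔥] [LieAlgebra 𝕜 𝔥]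

/-- The Leibniz rule for a linear endomorphism of a Lie algebra. -/
def IsLieDerivation (E : 𝔥 →ₗ[𝕜] 𝔥) : Prop := ∀ x y : 𝔥, E ⁅x, y⁆ = ⁅E x, y⁆ + ⁅x, E y⁆

/-- The restriction to `𝔥` of the adjoint representation of `𝔥 ⋊ 𝕜 E`, for a derivation `E`. -/
def derivationRep (E : 𝔥 →ₗ[𝕜] 𝔥) (hE : IsLieDerivation E) :
    𝔥 →ₗ⁅𝕜⁆ Module.End 𝕜 (𝔥 × 𝕜) where
  toFun l :=
    { toFun := fun m => (⁅l, m.1⁆ + m.2 • E l, 0)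
      map_add' := fun m m' => by
        ext
        · simp [add_smul]; abel
        · simp
      map_smul' := fun c m => by ext <;> simp [mul_smul] }
  map_add' l l' := by
    refine LinearMap.ext fun m => ?_
    ext
    · simp; abel
    · simp
  map_smul' c l := by
    refine LinearMap.ext fun m => ?_
    refine Prod.ext ?_ (by simp)
    show ⁅c • l, m.1⁆ + m.2 • E (c • l) = c • (⁅l, m.1⁆ + m.2 • E l)
    rw [smul_lie, map_smul, smul_add, smul_comm c m.2]
  map_lie' {l l'} := by
    refine LinearMap.ext fun m => ?_
    refine Prod.ext ?_ (sub_self (0 : 𝕜)).symm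
    show ⁅⁅l, l'⁆, m.1⁆ + m.2 • E ⁅l, l'⁆ = ⁅l, ⁅l', m.1⁆ + m.2 • E l'⁆ + (0 : 𝕜) • E l
      - (⁅l', ⁅l, m.1⁆ + m.2 • E l⁆ + (0 : 𝕜) • E l')
    rw [hE l l', lie_add, lie_add, lie_smul, lie_smul, lie_lie, ← lie_skew (E l) l', zero_smul,
      zero_smul, smul_add, smul_neg]
    abel

theorem derivationRep_apply (E : 𝔥 →ₗ[𝕜] 𝔥) (hE : IsLieDerivation E)
    (l : 𝔥) (m : 𝔥 × 𝕜) : derivationRep E hE l m = (⁅l, m.1⁆ + m.2 • E l, 0) := rfl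

end DerivationRepresentation

/-! ### Operators raising a filtration: simultaneous nilpotency. -/

section RaisingOperators

open Polynomial

variable {𝕜 : Type*} [Field 𝕜] {W : Type*} [AddCommGroup W] [Module 𝕜 W]

/-- The operators that raise the filtration `U` by `i` steps. -/
def raising (U : ℕ → Submodule 𝕜 W) (i : ℕ) : Submodule 𝕜 (Module.End 𝕜 W) where
  carrier := {T | ∀ k, ∀ v ∈ U k, T v ∈ U (k + i)}
  add_mem' hS hT k v hv := (U _).add_mem (hS k v hv) (hT k v hv)
  zero_mem' _ _ _ := (U _).zero_mem
  smul_mem' c _ hT k v hv := (U _).smul_mem c (hT k v hv)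

theorem raising_mul {U : ℕ → Submodule 𝕜 W} {i j : ℕ} {S T : Module.End 𝕜 W}
    (hS : S ∈ raising U i) (hT : T ∈ raising U j) : S * T ∈ raising U (i + j) := by
  intro k v hv
  have := hS _ _ (hT k v hv)
  rwa [show k + (i + j) = k + j + i by lia]

theorem raising_antitone {U : ℕ → Submodule 𝕜 W} (hU : Antitone U) : Antitone (raising U) :=
  fun _ _ hij _ hT k v hv => hU (Nat.add_le_add_left hij k) (hT k v hv)

theorem coeff_mul_mem_raising {U : ℕ → Submodule 𝕜 W} {i j : ℕ} {p q : (Module.End 𝕜 W)[X]}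
    (hp : ∀ n, p.coeff n ∈ raising U i) (hq : ∀ n, q.coeff n ∈ raising U j) (n : ℕ) :
    (p * q).coeff n ∈ raising U (i + j) := by
  rw [coeff_mul]
  exact Submodule.sum_mem _ fun x _ => raising_mul (hp _) (hq _)

theorem coeff_pow_mem_raising {U : ℕ → Submodule 𝕜 W} {p : (Module.End 𝕜 W)[X]}
    (hp : ∀ n, p.coeff n ∈ raising U 1) (k n : ℕ) : (p ^ k).coeff n ∈ raising U k := by
  induction k generalizing n with
  | zero =>
    rw [pow_zero, coeff_one]
    split_ifs
    · exact fun k v hv => hv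
    · exact Submodule.zero_mem _
  | succ k ih => rw [pow_succ]; exact coeff_mul_mem_raising ih hp n

theorem pow_eq_zero_of_coeff_mem_raising {U : ℕ → Submodule 𝕜 W} {N : ℕ} (h0 : U 0 = ⊤)
    (hN : U N = ⊥) {p : (Module.End 𝕜 W)[X]} (hp : ∀ n, p.coeff n ∈ raising U 1) : p ^ N = 0 := by
  ext n v
  have := coeff_pow_mem_raising hp N n 0 v (by rw [h0]; trivial)
  rw [zero_add, hN, Submodule.mem_bot] at this
  simpa using this

variable [Algebra ℚ (Module.End 𝕜 W)] [CharZero 𝕜]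

theorem coeff_exp_sub_one_mem_raising {U : ℕ → Submodule 𝕜 W} {N : ℕ} (hU : Antitone U)
    (h0 : U 0 = ⊤) (hN : U N = ⊥) {p : (Module.End 𝕜 W)[X]}
    (hp : ∀ n, p.coeff n ∈ raising U 1) (n : ℕ) :
    (IsNilpotent.exp p - 1).coeff n ∈ raising U 1 := by
  have hpN := pow_eq_zero_of_coeff_mem_raising h0 hN hp
  rw [IsNilpotent.exp_eq_sum (k := N + 1) (by rw [pow_succ, hpN, zero_mul]),
    Finset.sum_range_succ']
  simp only [pow_zero, Nat.factorial_zero, Nat.cast_one, inv_one, one_smul, add_sub_cancel_right,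
    finsetSum_coeff, coeff_smul]
  refine Submodule.sum_mem _ fun i _ => ?_
  rw [← Rat.cast_smul_eq_qsmul 𝕜]
  exact Submodule.smul_mem _ _ (raising_antitone hU (by lia) (coeff_pow_mem_raising hp (i + 1) n))

/-- A common filtration makes products and sums of raising operators nilpotent without any
commutation; this supplies the extra hypothesis of `exp_bch`. -/
theorem exp_mul_exp_sub_one_pow_eq_zero {U : ℕ → Submodule 𝕜 W} {N : ℕ} (hU : Antitone U)
    (h0 : U 0 = ⊤) (hN : U N = ⊥) {p q : (Module.End 𝕜 W)[X]}
    (hp : ∀ n, p.coeff n ∈ raising U 1) (hq : ∀ n, q.coeff n ∈ raising U 1) :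
    (IsNilpotent.exp p * IsNilpotent.exp q - 1) ^ N = 0 := by
  refine pow_eq_zero_of_coeff_mem_raising h0 hN fun n => ?_
  have e : IsNilpotent.exp p * IsNilpotent.exp q - 1
      = (IsNilpotent.exp p - 1) * (IsNilpotent.exp q - 1) + (IsNilpotent.exp p - 1)
        + (IsNilpotent.exp q - 1) := by
    rw [sub_mul, mul_sub, one_mul, mul_one]; abel
  have hp' := coeff_exp_sub_one_mem_raising hU h0 hN hp
  have hq' := coeff_exp_sub_one_mem_raising hU h0 hN hq
  rw [e, coeff_add, coeff_add]
  exact Submodule.add_mem _ (Submodule.add_mem _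
    (raising_antitone hU (by lia) (coeff_mul_mem_raising hp' hq' n)) (hp' n)) (hq' n)

end RaisingOperators

/-! ### The exponential of `bch` for raising operators. -/

section RaisingBCH

open Polynomial

attribute [local instance] LieRing.ofAssociativeRing

variable {𝕜 : Type*} [RCLike 𝕜] {W : Type*} [AddCommGroup W] [Module 𝕜 W]
  {U : ℕ → Submodule 𝕜 W} {N : ℕ}

theorem pow_eq_zero_of_mem_raising (h0 : U 0 = ⊤) (hN : U N = ⊥) {a : Module.End 𝕜 W}
    (ha : a ∈ raising U 1) : a ^ N = 0 := by
  have hC : ∀ n, (C a).coeff n ∈ raising U 1 := fun n => by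
    rw [coeff_C]
    split_ifs
    exacts [ha, Submodule.zero_mem _]
  have h := pow_eq_zero_of_coeff_mem_raising h0 hN hC
  rw [← C_pow] at h
  exact C_eq_zero.mp h

theorem exp_bch_of_mem_raising [Algebra ℚ (Module.End 𝕜 W)] (hU : Antitone U) (h0 : U 0 = ⊤)
    (hN : U N = ⊥)
    {a b : Module.End 𝕜 W} (ha : a ∈ raising U 1) (hb : b ∈ raising U 1) {M : ℕ}
    (hM : 2 * N + 1 ≤ M) :
    IsNilpotent.exp (bch 𝕜 M a b) = IsNilpotent.exp a * IsNilpotent.exp b := by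
  refine (exp_bch (𝕜 := 𝕜) (pow_eq_zero_of_mem_raising h0 hN ha)
    (pow_eq_zero_of_mem_raising h0 hN hb)
    (exp_mul_exp_sub_one_pow_eq_zero hU h0 hN (fun n => ?_) fun n => ?_) hM).1
  · rw [coeff_C]
    split_ifs
    exacts [ha, Submodule.zero_mem _]
  · rw [X_mul_C, coeff_C_mul_X]
    split_ifs
    exacts [hb, Submodule.zero_mem _]

end RaisingBCH

/-! ### Group identities after applying a derivation. -/

section DerivationGroup

open Polynomial

attribute [local instance] LieRing.ofAssociativeRing

variable {𝕜 : Type*} [RCLike 𝕜] {𝔥 : Type*} [LieRing 𝔥] [LieAlgebra 𝕜 𝔥] {N : ℕ}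

/-- The filtration of `𝔥 × 𝕜` that is raised by `derivationRep`. -/
def LieFiltration.extend (V : LieFiltration 𝕜 𝔥 N) : ℕ → Submodule 𝕜 (𝔥 × 𝕜)
  | 0 => ⊤
  | k + 1 => (V.toFun k).prod ⊥

theorem LieFiltration.extend_antitone (V : LieFiltration 𝕜 𝔥 N) : Antitone V.extend := by
  refine antitone_nat_of_succ_le fun k => ?_
  rcases k with _ | k
  · exact le_top
  · exact Submodule.prod_mono (V.antitone k.le_succ) le_rfl

theorem derivationRep_mem_raising (V : LieFiltration 𝕜 𝔥 N) (E : 𝔥 →ₗ[𝕜] 𝔥)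
    (hE : IsLieDerivation E) (l : 𝔥) :
    derivationRep E hE l ∈ raising V.extend 1 := by
  intro k v hv
  rw [derivationRep_apply]
  rcases k with _ | k
  · refine Submodule.mem_prod.mpr ⟨?_, Submodule.zero_mem _⟩
    rw [V.zero_eq_top]; trivial
  · obtain ⟨h1, h2⟩ := Submodule.mem_prod.mp hv
    refine Submodule.mem_prod.mpr ⟨?_, Submodule.zero_mem _⟩
    rw [(Submodule.mem_bot 𝕜).mp h2, zero_smul, add_zero]
    exact V.lie_mem _ _ _ h1


theorem derivationRep_pow_eq_zero (V : LieFiltration 𝕜 𝔥 N) (E : 𝔥 →ₗ[𝕜] 𝔥)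
    (hE : IsLieDerivation E) (x : 𝔥) :
    derivationRep E hE x ^ (N + 1) = 0 :=
  pow_eq_zero_of_mem_raising (U := V.extend) rfl (by simp [LieFiltration.extend, V.eq_bot])
    (derivationRep_mem_raising V E hE x)

theorem exp_derivationRep_bch [Algebra ℚ (Module.End 𝕜 (𝔥 × 𝕜))] (V : LieFiltration 𝕜 𝔥 N)
    (E : 𝔥 →ₗ[𝕜] 𝔥)
    (hE : IsLieDerivation E) {M : ℕ} (hM : 2 * (N + 1) + 1 ≤ M) (x y : 𝔥) :
    IsNilpotent.exp (derivationRep E hE (bch 𝕜 M x y))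
      = IsNilpotent.exp (derivationRep E hE x) * IsNilpotent.exp (derivationRep E hE y) := by
  rw [map_bch]
  exact exp_bch_of_mem_raising (N := N + 1) V.extend_antitone rfl
    (by simp [LieFiltration.extend, V.eq_bot]) (derivationRep_mem_raising V E hE x)
    (derivationRep_mem_raising V E hE y) hM

/-- The exponential is injective on nilpotents, and applying the operator of `x` to `(0, 1)` reads
off `E x`. -/
theorem eq_of_exp_derivationRep_eq [Algebra ℚ (Module.End 𝕜 (𝔥 × 𝕜))] (V : LieFiltration 𝕜 𝔥 N)
    (E : 𝔥 →ₗ[𝕜] 𝔥)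
    (hE : IsLieDerivation E) {x y : 𝔥}
    (h : IsNilpotent.exp (derivationRep E hE x) = IsNilpotent.exp (derivationRep E hE y)) :
    E x = E y := by
  have := exp_injective_of_nilpotent ⟨_, derivationRep_pow_eq_zero V E hE x⟩
    ⟨_, derivationRep_pow_eq_zero V E hE y⟩ h
  have h2 := congrArg Prod.fst (LinearMap.congr_fun this ((0, 1) : 𝔥 × 𝕜))
  simpa [derivationRep_apply] using h2

/-- Under `exp ∘ derivationRep`, `bch` becomes composition of operators, which is associative; only
the image under `E` can be recovered from the operator. -/
theorem derivation_bch_assoc [Algebra ℚ (Module.End 𝕜 (𝔥 × 𝕜))] (V : LieFiltration 𝕜 𝔥 N)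
    (E : 𝔥 →ₗ[𝕜] 𝔥)
    (hE : IsLieDerivation E) {M : ℕ} (hM : 2 * (N + 1) + 1 ≤ M)
    (x y z : 𝔥) :
    E (bch 𝕜 M (bch 𝕜 M x y) z) = E (bch 𝕜 M x (bch 𝕜 M y z)) := by
  refine eq_of_exp_derivationRep_eq V E hE ?_
  simp only [exp_derivationRep_bch V E hE hM, mul_assoc]

/-- `e^{ad x} y`, truncated after `M` terms. -/
noncomputable def expAd (𝕜 : Type*) [RCLike 𝕜] {𝔤 : Type*} [LieRing 𝔤] [LieAlgebra 𝕜 𝔤] (M : ℕ)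
    (x y : 𝔤) : 𝔤 :=
  ∑ n ∈ Finset.range M, (n.factorial : 𝕜)⁻¹ • (LieAlgebra.ad 𝕜 𝔤 x ^ n) y

theorem derivation_bch_conj [Algebra ℚ (Module.End 𝕜 (𝔥 × 𝕜))] (V : LieFiltration 𝕜 𝔥 N)
    (E : 𝔥 →ₗ[𝕜] 𝔥)
    (hE : IsLieDerivation E) {M : ℕ} (hM : 2 * (N + 1) + 1 ≤ M)
    (x y : 𝔥) :
    E (bch 𝕜 M (bch 𝕜 M x y) (-x)) = E (expAd 𝕜 M x y) := by
  refine eq_of_exp_derivationRep_eq V E hE ?_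
  set a := derivationRep E hE x with ha
  set b := derivationRep E hE y with hb
  have han : a ^ (N + 1) = 0 := derivationRep_pow_eq_zero V E hE x
  have hbn : b ^ (N + 1) = 0 := derivationRep_pow_eq_zero V E hE y
  -- The truncation at `M` loses nothing: `a^(N+1) = 0` gives `(ad a)^(2(N+1)) = 0`.
  have h1 : derivationRep E hE (expAd 𝕜 M x y) = IsNilpotent.exp a * b * IsNilpotent.exp (-a) := by
    rw [← exp_ad_apply (𝕜 := 𝕜) ⟨_, han⟩, IsNilpotent.exp_eq_sum
      (pow_eq_zero_of_le (show 2 * (N + 1) ≤ M by lia) (ad_pow_eq_zero han)), expAd, map_sum,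
      LinearMap.sum_apply]
    refine Finset.sum_congr rfl fun n _ => ?_
    rw [map_smul, map_ad_pow_apply, LinearMap.smul_apply, ← Rat.cast_smul_eq_qsmul 𝕜]
    push_cast
    rfl
  rw [exp_derivationRep_bch V E hE hM, exp_derivationRep_bch V E hE hM, map_neg, h1, ← ha, ← hb]
  have hinv : IsNilpotent.exp (-a) * IsNilpotent.exp a = 1 :=
    IsNilpotent.exp_neg_mul_exp_self ⟨_, han⟩
  have hinv' : IsNilpotent.exp a * IsNilpotent.exp (-a) = 1 :=
    IsNilpotent.exp_mul_exp_neg_self ⟨_, han⟩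
  have hpow : ∀ n : ℕ, (IsNilpotent.exp a * b * IsNilpotent.exp (-a)) ^ n
      = IsNilpotent.exp a * b ^ n * IsNilpotent.exp (-a) := by
    intro n
    induction n with
    | zero => rw [pow_zero, pow_zero, mul_one, hinv']
    | succ n ih =>
      rw [pow_succ, ih, pow_succ]
      simp only [mul_assoc]
      rw [← mul_assoc (IsNilpotent.exp (-a)) (IsNilpotent.exp a), hinv, one_mul]
  have hcn : (IsNilpotent.exp a * b * IsNilpotent.exp (-a)) ^ (N + 1) = 0 := by
    rw [hpow, hbn, mul_zero, zero_mul]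
  rw [IsNilpotent.exp_eq_sum hcn, IsNilpotent.exp_eq_sum hbn, Finset.mul_sum, Finset.sum_mul]
  refine Finset.sum_congr rfl fun n _ => ?_
  rw [hpow, mul_smul_comm, smul_mul_assoc]

end DerivationGroup

/-! ### The BCH group, through `𝕜[X] ⊗ 𝔤` and the Euler derivation. -/

section GroupLaw

open Polynomial TensorProduct

variable {𝕜 : Type*} [RCLike 𝕜] {𝔤 : Type*} [LieRing 𝔤] [LieAlgebra 𝕜 𝔤] {N : ℕ}

/-- The filtration of `𝕜[X] ⊗ 𝔤` induced by a filtration of `𝔤`. -/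
noncomputable def LieFiltration.polynomial (V : LieFiltration 𝕜 𝔤 N) :
    LieFiltration 𝕜 (𝕜[X] ⊗[𝕜] 𝔤) N where
  toFun k := Submodule.span 𝕜 {u | ∃ (p : 𝕜[X]) (m : 𝔤), m ∈ V.toFun k ∧ u = p ⊗ₜ m}
  antitone i j hij := Submodule.span_mono <| by
    rintro _ ⟨p, m, hm, rfl⟩; exact ⟨p, m, V.antitone hij hm, rfl⟩
  zero_eq_top := by
    rw [eq_top_iff, ← TensorProduct.span_tmul_eq_top]
    refine Submodule.span_mono ?_
    rintro _ ⟨p, m, rfl⟩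
    exact ⟨p, m, by rw [V.zero_eq_top]; trivial, rfl⟩
  eq_bot := by
    rw [eq_bot_iff, Submodule.span_le]
    rintro _ ⟨p, m, hm, rfl⟩
    rw [V.eq_bot, Submodule.mem_bot] at hm
    simp [hm]
  lie_mem k x m hm := by
    induction hm using Submodule.span_induction with
    | mem m hm =>
      obtain ⟨q, m, hm, rfl⟩ := hm
      induction x using TensorProduct.induction_on with
      | zero => rw [zero_lie]; exact Submodule.zero_mem _
      | tmul p x =>
        rw [LieAlgebra.ExtendScalars.bracket_tmul]
        exact Submodule.subset_span ⟨p * q, ⁅x, m⁆, V.lie_mem _ _ _ hm, rfl⟩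
      | add x y hx hy => rw [add_lie]; exact Submodule.add_mem _ hx hy
    | zero => rw [lie_zero]; exact Submodule.zero_mem _
    | add m m' _ _ h h' => rw [lie_add]; exact Submodule.add_mem _ h h'
    | smul c m _ h => rw [lie_smul]; exact Submodule.smul_mem _ _ h

/-- Evaluation at `c`, as a homomorphism `𝕜[X] ⊗ 𝔤 → 𝔤`. -/
noncomputable def evalLieHom (c : 𝕜) : 𝕜[X] ⊗[𝕜] 𝔤 →ₗ⁅𝕜⁆ 𝔤 where
  toLinearMap := (TensorProduct.lid 𝕜 𝔤).toLinearMap ∘ₗ LinearMap.rTensor 𝔤 (leval c)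
  map_lie' {x y} := by
    induction x using TensorProduct.induction_on with
    | zero => simp
    | add x x' hx hx' =>
      rw [add_lie]
      simp only [AddHom.toFun_eq_coe, LinearMap.coe_toAddHom, map_add] at hx hx' ⊢
      rw [hx, hx', add_lie]
    | tmul p x =>
      induction y using TensorProduct.induction_on with
      | zero => simp
      | add y y' hy hy' =>
        rw [lie_add]
        simp only [AddHom.toFun_eq_coe, LinearMap.coe_toAddHom, map_add] at hy hy' ⊢
        rw [hy, hy', lie_add]
      | tmul q y =>
        rw [LieAlgebra.ExtendScalars.bracket_tmul]
        simp [mul_smul, smul_comm (eval c p)]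

theorem evalLieHom_tmul (c : 𝕜) (p : 𝕜[X]) (x : 𝔤) :
    evalLieHom c (p ⊗ₜ[𝕜] x) = p.eval c • x := rfl

/-- The Euler derivation `X d/dX` of `𝕜[X] ⊗ 𝔤`. -/
noncomputable def eulerDerivation (𝕜 : Type*) [RCLike 𝕜] (𝔤 : Type*) [LieRing 𝔤]
    [LieAlgebra 𝕜 𝔤] : 𝕜[X] ⊗[𝕜] 𝔤 →ₗ[𝕜] 𝕜[X] ⊗[𝕜] 𝔤 :=
  LinearMap.rTensor 𝔤 (LinearMap.mulLeft 𝕜 X ∘ₗ derivative)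

theorem eulerDerivation_tmul (p : 𝕜[X]) (x : 𝔤) :
    eulerDerivation 𝕜 𝔤 (p ⊗ₜ[𝕜] x) = (X * derivative p) ⊗ₜ x := rfl

theorem isLieDerivation_eulerDerivation : IsLieDerivation (eulerDerivation 𝕜 𝔤) := by
  intro x y
  induction x using TensorProduct.induction_on with
  | zero => simp
  | add x x' hx hx' => simp only [add_lie, map_add, hx, hx']; abel
  | tmul p x =>
    induction y using TensorProduct.induction_on with
    | zero => simp
    | add y y' hy hy' => simp only [lie_add, map_add, hy, hy']; abel
    | tmul q y =>
      simp only [LieAlgebra.ExtendScalars.bracket_tmul, eulerDerivation_tmul, derivative_mul]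
      rw [← TensorProduct.add_tmul]
      congr 1
      ring

/-- The functional `∑ pₙ Xⁿ ↦ ∑_{n ≥ 1} pₙ / n`. -/
noncomputable def eulerIntegral (𝕜 : Type*) [RCLike 𝕜] : 𝕜[X] →ₗ[𝕜] 𝕜 :=
  Polynomial.lsum fun n => (n : 𝕜)⁻¹ • LinearMap.id

theorem eulerIntegral_X_mul_derivative (p : 𝕜[X]) :
    eulerIntegral 𝕜 (X * derivative p) = p.eval 1 - p.eval 0 := by
  induction p using Polynomial.induction_on' with
  | add p q hp hq => simp only [mul_add, map_add, hp, hq, eval_add]; ring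
  | monomial n c =>
    rcases n with _ | n
    · simp
    · have : ((n : 𝕜) + 1) ≠ 0 := by exact_mod_cast (Nat.cast_ne_zero (R := 𝕜)).mpr n.succ_ne_zero
      rw [derivative_monomial_succ, X_mul_monomial]
      simp [eulerIntegral, Polynomial.lsum_apply, Polynomial.sum_monomial_index]
      field_simp

/-- The Euler derivation kills only the constant part. Dividing the degree `n` part of its image by
`n` and summing recovers `u(1) - u(0)`. -/
theorem evalLieHom_eq_of_eulerDerivation_eq {u w : 𝕜[X] ⊗[𝕜] 𝔤}
    (h : eulerDerivation 𝕜 𝔤 u = eulerDerivation 𝕜 𝔤 w)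
    (h0 : evalLieHom (𝔤 := 𝔤) (0 : 𝕜) u = evalLieHom (𝔤 := 𝔤) (0 : 𝕜) w) :
    evalLieHom (𝔤 := 𝔤) (1 : 𝕜) u = evalLieHom (𝔤 := 𝔤) (1 : 𝕜) w := by
  set I : 𝕜[X] ⊗[𝕜] 𝔤 →ₗ[𝕜] 𝔤 :=
    (TensorProduct.lid 𝕜 𝔤).toLinearMap ∘ₗ LinearMap.rTensor 𝔤 (eulerIntegral 𝕜) with hI
  have key : ∀ u : 𝕜[X] ⊗[𝕜] 𝔤,
      I (eulerDerivation 𝕜 𝔤 u) = evalLieHom (𝔤 := 𝔤) (1 : 𝕜) u -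
        evalLieHom (𝔤 := 𝔤) (0 : 𝕜) u := by
    intro u
    induction u using TensorProduct.induction_on with
    | zero => simp
    | add x x' hx hx' => simp only [map_add, hx, hx']; abel
    | tmul p x =>
      rw [eulerDerivation_tmul, evalLieHom_tmul, evalLieHom_tmul, ← sub_smul,
        ← eulerIntegral_X_mul_derivative]
      rfl
  have := key u
  rw [h, key w, h0] at this
  exact (sub_left_inj.mp this).symm

theorem bch_assoc (V : LieFiltration 𝕜 𝔤 N) (hN : 1 ≤ N) (x y z : 𝔤) :
    bch 𝕜 N (bch 𝕜 N x y) z = bch 𝕜 N x (bch 𝕜 N y z) := by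
  let _ : Algebra ℚ (Module.End 𝕜 ((𝕜[X] ⊗[𝕜] 𝔤) × 𝕜)) := Algebra.compHom _ (algebraMap ℚ 𝕜)
  set M := 2 * (N + 1) + 1 with hM
  have hNM : N ≤ M := by lia
  -- At `X = 0` the arguments `X ⊗ x`, `X ⊗ y`, `X ⊗ z` all become `0`, so the initial values agree
  -- trivially.
  have h := evalLieHom_eq_of_eulerDerivation_eq
    (derivation_bch_assoc V.polynomial (eulerDerivation 𝕜 𝔤) isLieDerivation_eulerDerivation hM.ge
      (X ⊗ₜ x) (X ⊗ₜ y) (X ⊗ₜ z)) (by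
      simp [map_bch, evalLieHom_tmul, bch_of_lie_eq_zero (𝕜 := 𝕜) (hN.trans hNM)])
  simpa only [map_bch, evalLieHom_tmul, eval_X, one_smul, V.bch_eq_of_le hNM] using h

theorem bch_conj (V : LieFiltration 𝕜 𝔤 N) (hN : 1 ≤ N) (x y : 𝔤) :
    bch 𝕜 N (bch 𝕜 N x y) (-x) = expAd 𝕜 (2 * (N + 1) + 1) x y := by
  let _ : Algebra ℚ (Module.End 𝕜 ((𝕜[X] ⊗[𝕜] 𝔤) × 𝕜)) := Algebra.compHom _ (algebraMap ℚ 𝕜)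
  set M := 2 * (N + 1) + 1 with hM
  have hNM : N ≤ M := by lia
  have hmap : ∀ (c : 𝕜) (u w : 𝕜[X] ⊗[𝕜] 𝔤),
      evalLieHom c (expAd 𝕜 M u w) = expAd 𝕜 M (evalLieHom c u) (evalLieHom c w) := by
    intro c u w
    simp only [expAd, map_sum, map_smul, map_ad_pow_apply]
  have h := evalLieHom_eq_of_eulerDerivation_eq
    (derivation_bch_conj V.polynomial (eulerDerivation 𝕜 𝔤) isLieDerivation_eulerDerivation hM.ge
      (X ⊗ₜ x) (X ⊗ₜ y)) (by
      rw [hmap]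
      simp [map_bch, evalLieHom_tmul, bch_of_lie_eq_zero (𝕜 := 𝕜) (hN.trans hNM), expAd])
  simpa only [map_bch, hmap, map_neg, evalLieHom_tmul, eval_X, one_smul, V.bch_eq_of_le hNM]
    using h

/-- The group `(𝔤, ∗)`. -/
@[reducible]
noncomputable def bchGroup (V : LieFiltration 𝕜 𝔤 N) (hN : 1 ≤ N) : Group 𝔤 where
  mul x y := bch 𝕜 N x y
  mul_assoc := bch_assoc V hN
  one := 0
  one_mul x := (bch_of_lie_eq_zero hN (zero_lie x)).trans (zero_add x)
  mul_one x := (bch_of_lie_eq_zero hN (lie_zero x)).trans (add_zero x)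
  inv x := -x
  inv_mul_cancel x := (bch_of_lie_eq_zero hN (by rw [neg_lie, lie_self, neg_zero])).trans
    (neg_add_cancel x)

end GroupLaw

/-! ### Polynomial curves and directional derivatives by interpolation. -/

section PolynomialCurves

open Polynomial

variable {𝕜 : Type*} [RCLike 𝕜]

/-- The Lagrange basis polynomials for the nodes `0, 1, …, D`. -/
noncomputable def lagrangeNat (𝕜 : Type*) [RCLike 𝕜] (D i : ℕ) : 𝕜[X] :=
  Lagrange.basis (Finset.range (D + 1)) (fun n : ℕ => (n : 𝕜)) i

theorem injOn_natCast (s : Set ℕ) : Set.InjOn (fun n : ℕ => (n : 𝕜)) s :=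
  Nat.cast_injective.injOn

theorem eq_sum_lagrangeNat {D : ℕ} {P : 𝕜[X]} (hP : P.natDegree ≤ D) :
    P = ∑ i ∈ Finset.range (D + 1), C (P.eval (i : 𝕜)) * lagrangeNat 𝕜 D i := by
  have := Lagrange.eq_interpolate (s := Finset.range (D + 1)) (v := fun n : ℕ => (n : 𝕜))
    (f := P) (injOn_natCast _) (by
      rw [Finset.card_range]
      exact (degree_le_of_natDegree_le hP).trans_lt (by exact_mod_cast D.lt_succ_self))
  rwa [Lagrange.interpolate_apply] at this

theorem natDegree_lagrangeNat_le {D i : ℕ} (hi : i ∈ Finset.range (D + 1)) :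
    (lagrangeNat 𝕜 D i).natDegree ≤ D := by
  refine natDegree_le_of_degree_le ?_
  rw [lagrangeNat, Lagrange.degree_basis (injOn_natCast _) hi, Finset.card_range]
  simp

theorem lagrangeNat_eval_zero {D i : ℕ} (hi : i ∈ Finset.range (D + 1)) :
    (lagrangeNat 𝕜 D i).eval 0 = if i = 0 then 1 else 0 := by
  split_ifs with h
  · subst h
    have := Lagrange.eval_basis_self (s := Finset.range (D + 1)) (v := fun n : ℕ => (n : 𝕜))
      (injOn_natCast _) hi
    simpa [lagrangeNat] using this
  · have := Lagrange.eval_basis_of_ne (s := Finset.range (D + 1)) (v := fun n : ℕ => (n : 𝕜))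
      (i := i) (j := 0) h (by simp)
    simpa [lagrangeNat] using this

variable {F : Type*} [AddCommGroup F] [Module 𝕜 F]

/-- The polynomial curves of degree at most `D`. -/
def polyCurve (𝕜 : Type*) [RCLike 𝕜] (F : Type*) [AddCommGroup F] [Module 𝕜 F] (D : ℕ) :
    Submodule 𝕜 (𝕜 → F) :=
  Submodule.span 𝕜 {c | ∃ j ≤ D, ∃ w : F, c = fun t => t ^ j • w}

theorem pow_smul_mem_polyCurve {D j : ℕ} (hj : j ≤ D) (w : F) :
    (fun t : 𝕜 => t ^ j • w) ∈ polyCurve 𝕜 F D :=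
  Submodule.subset_span ⟨j, hj, w, rfl⟩

theorem const_mem_polyCurve (D : ℕ) (w : F) : (fun _ : 𝕜 => w) ∈ polyCurve 𝕜 F D := by
  simpa using pow_smul_mem_polyCurve (𝕜 := 𝕜) (Nat.zero_le D) w

theorem line_mem_polyCurve (x v : F) : (fun t : 𝕜 => x + t • v) ∈ polyCurve 𝕜 F 1 := by
  have := pow_smul_mem_polyCurve (𝕜 := 𝕜) (le_refl 1) v
  simp only [pow_one] at this
  exact Submodule.add_mem _ (const_mem_polyCurve 1 x) this

theorem polyCurve_mono : Monotone (polyCurve 𝕜 F) := fun _ _ h => Submodule.span_mono <| by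
  rintro _ ⟨j, hj, w, rfl⟩; exact ⟨j, hj.trans h, w, rfl⟩

theorem eval_smul_mem_polyCurve {D : ℕ} {P : 𝕜[X]} (hP : P.natDegree ≤ D) (w : F) :
    (fun t : 𝕜 => P.eval t • w) ∈ polyCurve 𝕜 F D := by
  have : (fun t : 𝕜 => P.eval t • w)
      = ∑ j ∈ Finset.range (D + 1), P.coeff j • fun t : 𝕜 => t ^ j • w := by
    ext t
    rw [eval_eq_sum_range' (Nat.lt_succ_of_le hP), Finset.sum_smul, Finset.sum_apply]
    exact Finset.sum_congr rfl fun j _ => by rw [Pi.smul_apply, smul_smul]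
  rw [this]
  exact Submodule.sum_mem _ fun j hj => Submodule.smul_mem _ _
    (pow_smul_mem_polyCurve (Nat.lt_succ_iff.mp (Finset.mem_range.mp hj)) w)

/-- Lagrange interpolation expresses being polynomial of degree at most `D` by equations, each
between finitely many values. Such conditions are closed under pointwise limits and can be tested
pointwise for function-valued curves. -/
theorem mem_polyCurve_iff {D : ℕ} {c : 𝕜 → F} : c ∈ polyCurve 𝕜 F D ↔
    ∀ t, c t = ∑ i ∈ Finset.range (D + 1), (lagrangeNat 𝕜 D i).eval t • c i := by
  constructor
  · intro hc
    induction hc using Submodule.span_induction with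
    | mem c hc =>
      obtain ⟨j, hj, w, rfl⟩ := hc
      intro t
      have := congrArg (eval t) (eq_sum_lagrangeNat (𝕜 := 𝕜) (D := D) (P := X ^ j)
        ((natDegree_X_pow_le j).trans hj))
      simp only [eval_pow, eval_X, eval_finsetSum, eval_mul, eval_C] at this
      simp only
      rw [this, Finset.sum_smul]
      exact Finset.sum_congr rfl fun i _ => by rw [smul_smul, mul_comm]
    | zero => simp
    | add c c' _ _ h h' => intro t; simp [h t, h' t, smul_add, Finset.sum_add_distrib]
    | smul a c _ h =>
      intro t
      simp only [Pi.smul_apply]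
      rw [h t, Finset.smul_sum]
      exact Finset.sum_congr rfl fun i _ => smul_comm _ _ _
  · intro h
    have : c = ∑ i ∈ Finset.range (D + 1), fun t => (lagrangeNat 𝕜 D i).eval t • c i := by
      ext t; rw [h t, Finset.sum_apply]
    rw [this]
    exact Submodule.sum_mem _ fun i hi => eval_smul_mem_polyCurve (natDegree_lagrangeNat_le hi) _

theorem map_mem_polyCurve {G : Type*} [AddCommGroup G] [Module 𝕜 G] (f : F →ₗ[𝕜] G) {D : ℕ}
    {c : 𝕜 → F} (hc : c ∈ polyCurve 𝕜 F D) : (fun t => f (c t)) ∈ polyCurve 𝕜 G D := by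
  rw [mem_polyCurve_iff] at hc ⊢
  intro t
  rw [hc t, map_sum]
  exact Finset.sum_congr rfl fun i _ => by rw [map_smul]

theorem map₂_mem_polyCurve {G H : Type*} [AddCommGroup G] [Module 𝕜 G] [AddCommGroup H]
    [Module 𝕜 H] (f : F →ₗ[𝕜] G →ₗ[𝕜] H) {m n : ℕ} {c : 𝕜 → F} {d : 𝕜 → G}
    (hc : c ∈ polyCurve 𝕜 F m) (hd : d ∈ polyCurve 𝕜 G n) :
    (fun t => f (c t) (d t)) ∈ polyCurve 𝕜 H (m + n) := by
  induction hc using Submodule.span_induction with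
  | mem c hc =>
    obtain ⟨i, hi, w, rfl⟩ := hc
    induction hd using Submodule.span_induction with
    | mem d hd =>
      obtain ⟨j, hj, z, rfl⟩ := hd
      simp only [map_smul, LinearMap.smul_apply, smul_smul, ← pow_add]
      exact pow_smul_mem_polyCurve (by lia) _
    | zero => simpa using const_mem_polyCurve (m + n) (0 : H)
    | add d d' _ _ h h' =>
      have := Submodule.add_mem _ h h'
      convert this using 1
      ext t
      simp
    | smul a d _ h =>
      have := Submodule.smul_mem _ a h
      convert this using 1
      ext t
      simp
  | zero => simpa using const_mem_polyCurve (m + n) (0 : H)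
  | add c c' _ _ h h' =>
    have := Submodule.add_mem _ h h'
    convert this using 1
    ext t
    simp
  | smul a c _ h =>
    have := Submodule.smul_mem _ a h
    convert this using 1
    ext t
    simp

/-- A function all of whose restrictions to affine lines are polynomials of degree at most `D`. -/
def IsLinePoly (𝕜 : Type*) [RCLike 𝕜] {E F : Type*} [AddCommGroup E] [Module 𝕜 E] [AddCommGroup F]
    [Module 𝕜 F] (D : ℕ) (f : E → F) : Prop :=
  ∀ x v : E, (fun t : 𝕜 => f (x + t • v)) ∈ polyCurve 𝕜 F D

variable {E : Type*} [AddCommGroup E] [Module 𝕜 E]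

theorem IsLinePoly.apply_add_smul {D : ℕ} {f : E → F} (hf : IsLinePoly 𝕜 D f) (x v : E) (t : 𝕜) :
    f (x + t • v)
      = ∑ i ∈ Finset.range (D + 1), (lagrangeNat 𝕜 D i).eval t • f (x + (i : 𝕜) • v) :=
  mem_polyCurve_iff.mp (hf x v) t

theorem IsLinePoly.comp_linear {E' : Type*} [AddCommGroup E'] [Module 𝕜 E'] {D : ℕ} {f : E → F}
    (hf : IsLinePoly 𝕜 D f) (g : E' →ₗ[𝕜] E) (a : E) : IsLinePoly 𝕜 D fun x => f (a + g x) := by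
  intro x v
  simpa [add_assoc] using hf (a + g x) (g v)

theorem isLinePoly_sum_smul {ι : Type*} {D : ℕ} (s : Finset ι) (a : ι → 𝕜) {f : ι → E → F}
    (hf : ∀ i ∈ s, IsLinePoly 𝕜 D (f i)) : IsLinePoly 𝕜 D fun x => ∑ i ∈ s, a i • f i x := by
  intro x v
  have := Submodule.sum_mem _ fun i hi => Submodule.smul_mem _ (a i) (hf i hi x v)
  convert this using 1
  ext t
  simp

/-- The weights `wᵢ` of the formula `(dP/dX)(0) = ∑ᵢ wᵢ P(i)`, exact in degree at most `D`. -/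
noncomputable def diffWeight (𝕜 : Type*) [RCLike 𝕜] (D i : ℕ) : 𝕜 :=
  (derivative (lagrangeNat 𝕜 D i)).eval 0

/-- The directional derivative at `x` of a function that is polynomial of degree at most `D` along
lines. -/
noncomputable def lineDer (𝕜 : Type*) [RCLike 𝕜] {E F : Type*} [AddCommGroup E] [Module 𝕜 E]
    [AddCommGroup F] [Module 𝕜 F] (D : ℕ) (f : E → F) (v x : E) : F :=
  ∑ i ∈ Finset.range (D + 1), diffWeight 𝕜 D i • f (x + (i : 𝕜) • v)

/-- Continuity of `t ↦ t • a` is a hypothesis rather than an instance: on all continuous functions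
it can fail, since these may be unbounded on bounded sets. -/
theorem tendsto_slope_polyCurve [TopologicalSpace F] [ContinuousAdd F]
    (hF : ∀ a : F, Continuous fun t : 𝕜 => t • a) {D : ℕ} {c : 𝕜 → F}
    (hc : c ∈ polyCurve 𝕜 F D) :
    Tendsto (fun t : 𝕜 => t⁻¹ • (c t - c 0)) (𝓝[≠] 0)
      (𝓝 (∑ i ∈ Finset.range (D + 1), diffWeight 𝕜 D i • c i)) := by
  rw [mem_polyCurve_iff] at hc
  have e : ∀ t : 𝕜, t⁻¹ • (c t - c 0) = ∑ i ∈ Finset.range (D + 1),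
      slope (fun s => (lagrangeNat 𝕜 D i).eval s) 0 t • c i := by
    intro t
    rw [hc t, hc 0, ← Finset.sum_sub_distrib, Finset.smul_sum]
    refine Finset.sum_congr rfl fun i _ => ?_
    rw [← sub_smul, smul_smul, slope_def_module, sub_zero, smul_eq_mul]
  simp only [e]
  refine tendsto_finsetSum _ fun i _ => ?_
  have := hasDerivAt_iff_tendsto_slope.mp ((lagrangeNat 𝕜 D i).hasDerivAt 0)
  exact ((hF (c i)).tendsto _).comp this

theorem hasDerivAt_polyCurve {D : ℕ} {c : 𝕜 → 𝕜} (hc : c ∈ polyCurve 𝕜 𝕜 D) :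
    HasDerivAt c (∑ i ∈ Finset.range (D + 1), diffWeight 𝕜 D i • c i) 0 := by
  rw [hasDerivAt_iff_tendsto_slope]
  have := tendsto_slope_polyCurve (fun a => continuous_id.smul continuous_const) hc
  refine this.congr fun t => ?_
  rw [slope_def_module, sub_zero]

theorem IsLinePoly.hasDerivAt {D : ℕ} {f : E → 𝕜} (hf : IsLinePoly 𝕜 D f) (x v : E) :
    HasDerivAt (fun t : 𝕜 => f (x + t • v)) (lineDer 𝕜 D f v x) 0 :=
  hasDerivAt_polyCurve (hf x v)

theorem IsLinePoly.lineDer {D : ℕ} {f : E → F} (hf : IsLinePoly 𝕜 D f) (v : E) :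
    IsLinePoly 𝕜 D (lineDer 𝕜 D f v) :=
  isLinePoly_sum_smul _ _ fun i _ => by
    simpa [add_comm] using hf.comp_linear LinearMap.id ((i : 𝕜) • v)

theorem IsLinePoly.lineDer_smul {D : ℕ} {f : E → 𝕜} (hf : IsLinePoly 𝕜 D f) (a : 𝕜) (v x : E) :
    _root_.lineDer 𝕜 D f (a • v) x = a • _root_.lineDer 𝕜 D f v x := by
  have h1 := hf.hasDerivAt x (a • v)
  have h2 : HasDerivAt (fun t : 𝕜 => f (x + (t * a) • v)) (_root_.lineDer 𝕜 D f v x * a) 0 := by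
    have h3 : HasDerivAt (fun t : 𝕜 => f (x + t • v)) (_root_.lineDer 𝕜 D f v x) (0 * a) := by
      rw [zero_mul]; exact hf.hasDerivAt x v
    exact h3.comp (0 : 𝕜) (by simpa using (hasDerivAt_id (0 : 𝕜)).mul_const a)
  simp only [mul_smul] at h2
  rw [h1.unique h2, smul_eq_mul, mul_comm]

/-- Additivity in the direction without joint differentiability: interpolate in the `v` direction
only, then apply the product rule. At `t = 0` the Lagrange basis selects the node `0`, leaving the
`u` derivative, while its derivatives form the `v` derivative. -/
theorem IsLinePoly.lineDer_add {D : ℕ} {f : E → 𝕜} (hf : IsLinePoly 𝕜 D f) (u v x : E) :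
    _root_.lineDer 𝕜 D f (u + v) x = _root_.lineDer 𝕜 D f u x + _root_.lineDer 𝕜 D f v x := by
  have h1 := hf.hasDerivAt x (u + v)
  have e : (fun t : 𝕜 => f (x + t • (u + v))) = fun t : 𝕜 => ∑ i ∈ Finset.range (D + 1),
      (lagrangeNat 𝕜 D i).eval t * f ((x + (i : 𝕜) • v) + t • u) := by
    ext t
    rw [smul_add, ← add_assoc, hf.apply_add_smul]
    exact Finset.sum_congr rfl fun i _ => by rw [smul_eq_mul, add_right_comm]
  have h2 : HasDerivAt (fun t : 𝕜 => ∑ i ∈ Finset.range (D + 1),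
      (lagrangeNat 𝕜 D i).eval t * f ((x + (i : 𝕜) • v) + t • u))
      (∑ i ∈ Finset.range (D + 1), (diffWeight 𝕜 D i * f ((x + (i : 𝕜) • v) + (0 : 𝕜) • u)
        + (lagrangeNat 𝕜 D i).eval 0 * _root_.lineDer 𝕜 D f u (x + (i : 𝕜) • v))) 0 :=
    HasDerivAt.fun_sum fun i _ => ((lagrangeNat 𝕜 D i).hasDerivAt 0).mul (hf.hasDerivAt _ _)
  rw [e] at h1
  rw [h1.unique h2, Finset.sum_add_distrib, add_comm]
  congr 1
  · rw [Finset.sum_eq_single_of_mem 0 (by simp)]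
    · rw [lagrangeNat_eval_zero (by simp)]; simp
    · intro i hi h0
      rw [lagrangeNat_eval_zero hi, if_neg h0, zero_mul]
  · simp [_root_.lineDer]

end PolynomialCurves

/-! ### Smoothness of continuous maps that are polynomial along lines. -/

section MichalBastiani

/-- The differential `(x, v) ↦ ∑ wᵢ f (x + i v)` is a finite combination of values of `f`, so it is
again continuous and polynomial along lines with the same `D`; the induction runs over all `E`. -/
theorem IsLinePoly.isCk {𝕜 : Type*} [RCLike 𝕜] {F : Type*} [AddCommGroup F] [Module 𝕜 F]
    [TopologicalSpace F] [ContinuousAdd F] [ContinuousConstSMul 𝕜 F]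
    (hF : ∀ a : F, Continuous fun t : 𝕜 => t • a) {D : ℕ} (k : ℕ) (E : Type u) [AddCommGroup E]
    [Module 𝕜 E] [TopologicalSpace E] [ContinuousAdd E] [ContinuousConstSMul 𝕜 E] {f : E → F}
    (hc : Continuous f) (hf : IsLinePoly 𝕜 D f) : IsCk 𝕜 k E f := by
  induction k generalizing E with
  | zero => exact hc
  | succ k ih =>
    refine ⟨hc, fun p => _root_.lineDer 𝕜 D f p.2 p.1, fun x v => ?_, ih (E × E) ?_ ?_⟩
    · have := tendsto_slope_polyCurve hF (hf x v)
      simp only [zero_smul, add_zero] at this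
      exact this
    · refine continuous_finsetSum _ fun i _ => Continuous.const_smul (hc.comp ?_) _
      exact continuous_fst.add (continuous_snd.const_smul _)
    · refine isLinePoly_sum_smul _ _ fun i _ => ?_
      simpa using hf.comp_linear (LinearMap.fst 𝕜 E E + (i : 𝕜) • LinearMap.snd 𝕜 E E) 0

end MichalBastiani

/-! ### From polynomials along lines to sums of continuous multilinear forms. -/

section ContinuousPolynomials

open Polynomial

variable {𝕜 : Type*} [RCLike 𝕜] {E : Type*} [AddCommGroup E] [Module 𝕜 E]

/-- The iterated directional derivative in the directions `v 0, …, v (j - 1)`. -/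
noncomputable def iterLineDer (𝕜 : Type*) [RCLike 𝕜] {E : Type*} [AddCommGroup E] [Module 𝕜 E]
    (D : ℕ) (f : E → 𝕜) : (j : ℕ) → (Fin j → E) → E → 𝕜
  | 0, _ => f
  | j + 1, v => lineDer 𝕜 D (iterLineDer 𝕜 D f j (Fin.tail v)) (v 0)

theorem isLinePoly_iterLineDer {D : ℕ} {f : E → 𝕜} (hf : IsLinePoly 𝕜 D f) (j : ℕ)
    (v : Fin j → E) : IsLinePoly 𝕜 D (iterLineDer 𝕜 D f j v) := by
  induction j with
  | zero => exact hf
  | succ j ih => exact (ih _).lineDer _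

theorem continuous_iterLineDer [TopologicalSpace E] [ContinuousAdd E] [ContinuousConstSMul 𝕜 E]
    {f : E → 𝕜} (hf : Continuous f) (D j : ℕ) :
    Continuous fun p : (Fin j → E) × E => iterLineDer 𝕜 D f j p.1 p.2 := by
  induction j with
  | zero => exact hf.comp continuous_snd
  | succ j ih =>
    have h : ∀ i : ℕ, Continuous fun p : (Fin (j + 1) → E) × E =>
        ((Fin.tail p.1, p.2 + (i : 𝕜) • p.1 0) : (Fin j → E) × E) := fun i =>
      Continuous.prodMk (continuous_pi fun k => (continuous_apply k.succ).comp continuous_fst)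
        (continuous_snd.add (((continuous_apply 0).comp continuous_fst).const_smul _))
    simp only [iterLineDer, lineDer]
    exact continuous_finsetSum _ fun i _ => (ih.comp (h i)).const_smul (diffWeight 𝕜 D i)

theorem iterLineDer_update_add {D : ℕ} {f : E → 𝕜} (hf : IsLinePoly 𝕜 D f) (j : ℕ)
    (v : Fin j → E) (i : Fin j) (a b x : E) :
    iterLineDer 𝕜 D f j (Function.update v i (a + b)) x
      = iterLineDer 𝕜 D f j (Function.update v i a) x
        + iterLineDer 𝕜 D f j (Function.update v i b) x := by
  induction j generalizing x with
  | zero => exact i.elim0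
  | succ j ih =>
    refine Fin.cases ?_ (fun i => ?_) i
    · simp only [iterLineDer, Fin.tail_update_zero, Function.update_self]
      exact (isLinePoly_iterLineDer hf _ _).lineDer_add _ _ _
    · simp only [iterLineDer, Fin.tail_update_succ, lineDer, ih, smul_add,
        Function.update_of_ne (Fin.succ_ne_zero i).symm, Finset.sum_add_distrib]

theorem iterLineDer_update_smul {D : ℕ} {f : E → 𝕜} (hf : IsLinePoly 𝕜 D f) (j : ℕ)
    (v : Fin j → E) (i : Fin j) (c : 𝕜) (a x : E) :
    iterLineDer 𝕜 D f j (Function.update v i (c • a)) x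
      = c • iterLineDer 𝕜 D f j (Function.update v i a) x := by
  induction j generalizing x with
  | zero => exact i.elim0
  | succ j ih =>
    refine Fin.cases ?_ (fun i => ?_) i
    · simp only [iterLineDer, Fin.tail_update_zero, Function.update_self]
      exact (isLinePoly_iterLineDer hf _ _).lineDer_smul _ _ _
    · simp only [iterLineDer, Fin.tail_update_succ, lineDer, ih,
        Function.update_of_ne (Fin.succ_ne_zero i).symm, Finset.smul_sum, smul_comm c]

/-- The iterated directional derivative at `x`, as a continuous multilinear form. -/
noncomputable def iterLineDerForm [TopologicalSpace E] [ContinuousAdd E] [ContinuousConstSMul 𝕜 E]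
    {D : ℕ} {f : E → 𝕜} (hf : IsLinePoly 𝕜 D f) (hc : Continuous f) (j : ℕ) (x : E) :
    ContinuousMultilinearMap 𝕜 (fun _ : Fin j => E) 𝕜 where
  toFun v := iterLineDer 𝕜 D f j v x
  map_update_add' {inst} v i a b := by
    rw [Subsingleton.elim inst (instDecidableEqFin j)]
    exact iterLineDer_update_add hf j v i a b x
  map_update_smul' {inst} v i c a := by
    rw [Subsingleton.elim inst (instDecidableEqFin j)]
    exact iterLineDer_update_smul hf j v i c a x
  cont := (continuous_iterLineDer hc D j).comp (continuous_id.prodMk continuous_const)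

theorem exists_polynomial_of_mem_polyCurve {D : ℕ} {c : 𝕜 → 𝕜} (hc : c ∈ polyCurve 𝕜 𝕜 D) :
    ∃ P : 𝕜[X], P.natDegree ≤ D ∧ ∀ t, c t = P.eval t := by
  refine ⟨∑ i ∈ Finset.range (D + 1), C (c i) * lagrangeNat 𝕜 D i, ?_, fun t => ?_⟩
  · exact natDegree_sum_le_of_forall_le _ _ fun i hi =>
      (natDegree_C_mul_le _ _).trans (natDegree_lagrangeNat_le hi)
  · rw [mem_polyCurve_iff.mp hc t, eval_finsetSum]
    exact Finset.sum_congr rfl fun i _ => by rw [eval_mul, eval_C, smul_eq_mul, mul_comm]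

theorem IsLinePoly.lineDer_eq_eval_derivative {D : ℕ} {f : E → 𝕜} (hf : IsLinePoly 𝕜 D f) {y : E}
    {P : 𝕜[X]} (hP : ∀ t : 𝕜, f (t • y) = P.eval t) (t : 𝕜) :
    _root_.lineDer 𝕜 D f y (t • y) = (derivative P).eval t := by
  have h1 := hf.hasDerivAt (t • y) y
  simp only [← add_smul, hP] at h1
  have h2 : HasDerivAt (fun s : 𝕜 => P.eval (t + s)) ((derivative P).eval t) 0 := by
    have h3 : HasDerivAt (fun s : 𝕜 => P.eval s) ((derivative P).eval t) (t + 0) := by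
      rw [add_zero]; exact P.hasDerivAt t
    exact h3.comp_const_add t 0
  exact h1.unique h2

theorem eval_one_eq_sum_derivative {D : ℕ} {P : 𝕜[X]} (hP : P.natDegree ≤ D) :
    P.eval 1 = ∑ j ∈ Finset.range (D + 1),
      (j.factorial : 𝕜)⁻¹ * (derivative^[j] P).eval 0 := by
  rw [eval_eq_sum_range' (Nat.lt_succ_of_le hP)]
  refine Finset.sum_congr rfl fun j _ => ?_
  rw [← coeff_zero_eq_eval_zero, coeff_iterate_derivative, zero_add, Nat.descFactorial_self,
    one_pow, mul_one, nsmul_eq_mul, inv_mul_cancel_left₀]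
  exact_mod_cast j.factorial_ne_zero

/-- Taylor's formula at `0`: the `j`-th form is the `j`-th iterated directional derivative divided
by `j!`, and on the diagonal it is the one-variable Taylor term of `t ↦ φ (t y)`. -/
theorem mem_contPoly_of_isLinePoly [TopologicalSpace E] [ContinuousAdd E]
    [ContinuousConstSMul 𝕜 E] {D : ℕ} {φ : ContFun 𝕜 E} (hφ : IsLinePoly 𝕜 D φ) :
    φ ∈ ContPoly 𝕜 E D := by
  refine ⟨fun j => (j.factorial : 𝕜)⁻¹ • iterLineDerForm hφ φ.continuous j 0, fun y => ?_⟩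
  obtain ⟨P, hPD, hP⟩ := exists_polynomial_of_mem_polyCurve (hφ 0 y)
  simp only [zero_add] at hP
  have key : ∀ (j : ℕ) (t : 𝕜), iterLineDer 𝕜 D φ j (fun _ => y) (t • y)
      = (derivative^[j] P).eval t := by
    intro j
    induction j with
    | zero => exact hP
    | succ j ih =>
      intro t
      rw [Function.iterate_succ_apply']
      exact (isLinePoly_iterLineDer hφ j _).lineDer_eq_eval_derivative ih t
  have h1 := hP 1
  rw [one_smul, eval_one_eq_sum_derivative hPD] at h1
  rw [h1]
  refine Finset.sum_congr rfl fun j _ => ?_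
  rw [← key j 0, zero_smul]
  rfl

end ContinuousPolynomials

/-! ### Degree, continuity and boundedness of `bch`. -/

section BCHAnalysis

variable {𝕜 : Type*} [RCLike 𝕜] {𝔤 : Type*} [LieRing 𝔤] [LieAlgebra 𝕜 𝔤]

theorem ad_pow_mem_polyCurve {m n : ℕ} {c d : 𝕜 → 𝔤} (hc : c ∈ polyCurve 𝕜 𝔤 m)
    (hd : d ∈ polyCurve 𝕜 𝔤 n) (k : ℕ) :
    (fun t => (LieAlgebra.ad 𝕜 𝔤 (c t) ^ k) (d t)) ∈ polyCurve 𝕜 𝔤 (k * m + n) := by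
  induction k with
  | zero => simpa using hd
  | succ k ih =>
    have := map₂_mem_polyCurve (LieAlgebra.ad 𝕜 𝔤 : 𝔤 →ₗ[𝕜] Module.End 𝕜 𝔤) hc ih
    rw [show (k + 1) * m + n = m + (k * m + n) by ring]
    simpa only [pow_succ', Module.End.mul_apply] using! this

theorem adWord_mem_polyCurve {m n : ℕ} {c d z : 𝕜 → 𝔤} (hc : c ∈ polyCurve 𝕜 𝔤 m)
    (hd : d ∈ polyCurve 𝕜 𝔤 m) (hz : z ∈ polyCurve 𝕜 𝔤 n) (l : List (ℕ × ℕ)) :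
    (fun t => adWord 𝕜 (c t) (d t) l (z t))
      ∈ polyCurve 𝕜 𝔤 ((l.map fun q => q.1 + q.2).sum * m + n) := by
  induction l with
  | nil => simpa [adWord] using hz
  | cons q l ih =>
    simp only [adWord, List.map_cons, List.prod_cons, Module.End.mul_apply, List.sum_cons] at ih ⊢
    have := ad_pow_mem_polyCurve hc (ad_pow_mem_polyCurve hd ih q.2) q.1
    convert this using 2
    ring

/-- A surviving word has at most `N - 1` operators and one final argument, hence at most `N` factors
of degree `m`. -/
theorem bch_mem_polyCurve {N : ℕ} (V : LieFiltration 𝕜 𝔤 N) (hN : 1 ≤ N) {m : ℕ} {c d : 𝕜 → 𝔤}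
    (hc : c ∈ polyCurve 𝕜 𝔤 m) (hd : d ∈ polyCurve 𝕜 𝔤 m) :
    (fun t => bch 𝕜 N (c t) (d t)) ∈ polyCurve 𝕜 𝔤 (N * m) := by
  have e : (fun t => bch 𝕜 N (c t) (d t)) = c + ∑ k ∈ Finset.range N,
      ∑ p ∈ Fintype.piFinset (fun _ : Fin k => bchExponents N), ∑ r ∈ Finset.range N,
        bchCoeff 𝕜 p r • fun t => adWord 𝕜 (c t) (d t) (List.ofFn p)
          ((LieAlgebra.ad 𝕜 𝔤 (c t) ^ r) (d t)) := by
    ext t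
    simp only [bch_eq_sum, Pi.add_apply, Finset.sum_apply, Pi.smul_apply]
  rw [e]
  refine Submodule.add_mem _ (polyCurve_mono (Nat.le_mul_of_pos_left m hN) hc)
    (Submodule.sum_mem _ fun k _ => Submodule.sum_mem _ fun p _ => Submodule.sum_mem _ fun r _ =>
      Submodule.smul_mem _ _ ?_)
  by_cases h : N ≤ r + ∑ i, ((p i).1 + (p i).2)
  · simp only [V.adWord_ofFn_apply_eq_zero _ _ _ p r h]
    exact const_mem_polyCurve _ 0
  · refine polyCurve_mono ?_ (adWord_mem_polyCurve hc hd (ad_pow_mem_polyCurve hc hd r) _)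
    rw [List.map_ofFn, List.sum_ofFn]
    calc _ = (r + ∑ i, ((p i).1 + (p i).2) + 1) * m := by simp only [Function.comp_apply]; ring
      _ ≤ N * m := Nat.mul_le_mul_right _ (by lia)

variable [TopologicalSpace 𝔤] [ContinuousLieBracket 𝔤]

theorem Continuous.ad_pow_apply {Y : Type*} [TopologicalSpace Y] {f g : Y → 𝔤} (hf : Continuous f)
    (hg : Continuous g) (n : ℕ) : Continuous fun y => (LieAlgebra.ad 𝕜 𝔤 (f y) ^ n) (g y) := by
  induction n with
  | zero => simpa using hg
  | succ n ih =>
    simp only [pow_succ', Module.End.mul_apply, LieAlgebra.ad_apply]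
    exact ContinuousLieBracket.continuous_bracket.comp (hf.prodMk ih)

theorem Continuous.bch [ContinuousAdd 𝔤] [ContinuousConstSMul 𝕜 𝔤] {Y : Type*}
    [TopologicalSpace Y] {f g : Y → 𝔤} (hf : Continuous f) (hg : Continuous g) (N : ℕ) :
    Continuous fun y => bch 𝕜 N (f y) (g y) := by
  have key : ∀ (l : List (ℕ × ℕ)) {z : Y → 𝔤}, Continuous z →
      Continuous fun y => adWord 𝕜 (f y) (g y) l (z y) := by
    intro l z hz
    induction l with
    | nil => simpa [adWord] using hz
    | cons q l ih =>
      simp only [adWord, List.map_cons, List.prod_cons, Module.End.mul_apply] at ih ⊢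
      exact hf.ad_pow_apply (hg.ad_pow_apply ih _) _
  simp only [bch_eq_sum]
  exact hf.add (continuous_finsetSum _ fun k _ => continuous_finsetSum _ fun p _ =>
    continuous_finsetSum _ fun m _ => (key _ (hf.ad_pow_apply hg m)).const_smul _)

section Boundedness

set_option linter.unusedSectionVars false

theorem isVonNBounded_range_iff {E : Type*} [AddCommGroup E] [Module 𝕜 E] [TopologicalSpace E]
    [ContinuousSMul 𝕜 E] {ε : ℕ → 𝕜} (hε : Tendsto ε atTop (𝓝[≠] 0)) {ι : Type*} {f : ι → E} :
    Bornology.IsVonNBounded 𝕜 (Set.range f) ↔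
      ∀ s : ℕ → ι, Tendsto (fun n => ε n • f (s n)) atTop (𝓝 0) := by
  rw [Bornology.isVonNBounded_iff_smul_tendsto_zero hε]
  constructor
  · exact fun h s => h (fun n => f (s n)) fun n => ⟨s n, rfl⟩
  · intro h x hx
    choose s hs using hx
    have := h s
    simp only [hs] at this
    exact this

theorem exists_tendsto_nhdsNE_zero (𝕜 : Type*) [RCLike 𝕜] :
    ∃ ε : ℕ → 𝕜, Tendsto ε atTop (𝓝[≠] 0) := by
  refine ⟨fun n => ((n : 𝕜) + 1)⁻¹, tendsto_nhdsWithin_iff.mpr ⟨?_, Eventually.of_forall ?_⟩⟩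
  · have := (tendsto_one_div_add_atTop_nhds_zero_nat (𝕜 := 𝕜))
    simpa using this
  · intro n
    have : ((n : 𝕜) + 1) ≠ 0 := by exact_mod_cast n.succ_ne_zero
    simpa using this

variable [IsTopologicalAddGroup 𝔤] [ContinuousSMul 𝕜 𝔤] {ι : Type*}

theorem isVonNBounded_range_add {f g : ι → 𝔤} (hf : Bornology.IsVonNBounded 𝕜 (Set.range f))
    (hg : Bornology.IsVonNBounded 𝕜 (Set.range g)) :
    Bornology.IsVonNBounded 𝕜 (Set.range fun i => f i + g i) := by
  obtain ⟨ε, hε⟩ := exists_tendsto_nhdsNE_zero 𝕜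
  rw [isVonNBounded_range_iff hε] at *
  intro s
  simpa only [smul_add, add_zero] using (hf s).add (hg s)

theorem isVonNBounded_range_const_smul {f : ι → 𝔤} (hf : Bornology.IsVonNBounded 𝕜 (Set.range f))
    (a : 𝕜) : Bornology.IsVonNBounded 𝕜 (Set.range fun i => a • f i) := by
  obtain ⟨ε, hε⟩ := exists_tendsto_nhdsNE_zero 𝕜
  rw [isVonNBounded_range_iff hε] at *
  intro s
  simpa only [smul_comm a, smul_zero] using (hf s).const_smul a

theorem isVonNBounded_range_sum {κ : Type*} (S : Finset κ) {f : κ → ι → 𝔤}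
    (hf : ∀ k ∈ S, Bornology.IsVonNBounded 𝕜 (Set.range (f k))) :
    Bornology.IsVonNBounded 𝕜 (Set.range fun i => ∑ k ∈ S, f k i) := by
  obtain ⟨ε, hε⟩ := exists_tendsto_nhdsNE_zero 𝕜
  simp only [isVonNBounded_range_iff hε] at *
  intro s
  simpa only [Finset.smul_sum, Finset.sum_const_zero] using
    tendsto_finsetSum S fun k hk => hf k hk s

/-- Boundedness is tested with the scalars `εₙ²`, so that each argument of the bracket absorbs one
`εₙ` and continuity at `(0, 0)` suffices. -/
theorem isVonNBounded_range_lie {f g : ι → 𝔤} (hf : Bornology.IsVonNBounded 𝕜 (Set.range f))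
    (hg : Bornology.IsVonNBounded 𝕜 (Set.range g)) :
    Bornology.IsVonNBounded 𝕜 (Set.range fun i => ⁅f i, g i⁆) := by
  obtain ⟨ε, hε⟩ := exists_tendsto_nhdsNE_zero 𝕜
  have hε2 : Tendsto (fun n => ε n * ε n) atTop (𝓝[≠] 0) := by
    rw [tendsto_nhdsWithin_iff] at hε ⊢
    refine ⟨by simpa using hε.1.mul hε.1, hε.2.mono fun n hn => ?_⟩
    exact mul_ne_zero hn hn
  rw [isVonNBounded_range_iff hε] at hf hg
  rw [isVonNBounded_range_iff hε2]
  intro s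
  have h := (ContinuousLieBracket.continuous_bracket (𝔤 := 𝔤)).tendsto (0, 0)
  have h' := h.comp ((hf s).prodMk_nhds (hg s))
  simpa only [Function.comp_def, lie_smul, smul_lie, smul_smul, lie_zero] using h'

theorem isVonNBounded_range_bch {f g : ι → 𝔤} (hf : Bornology.IsVonNBounded 𝕜 (Set.range f))
    (hg : Bornology.IsVonNBounded 𝕜 (Set.range g)) (N : ℕ) :
    Bornology.IsVonNBounded 𝕜 (Set.range fun i => bch 𝕜 N (f i) (g i)) := by
  have hpow : ∀ {f z : ι → 𝔤}, Bornology.IsVonNBounded 𝕜 (Set.range f) →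
      Bornology.IsVonNBounded 𝕜 (Set.range z) → ∀ n : ℕ,
      Bornology.IsVonNBounded 𝕜 (Set.range fun i => (LieAlgebra.ad 𝕜 𝔤 (f i) ^ n) (z i)) := by
    intro f z hf hz n
    induction n with
    | zero => simpa using hz
    | succ n ih =>
      simp only [pow_succ', Module.End.mul_apply, LieAlgebra.ad_apply]
      exact isVonNBounded_range_lie hf ih
  have key : ∀ (l : List (ℕ × ℕ)) {z : ι → 𝔤}, Bornology.IsVonNBounded 𝕜 (Set.range z) →
      Bornology.IsVonNBounded 𝕜 (Set.range fun i => adWord 𝕜 (f i) (g i) l (z i)) := by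
    intro l z hz
    induction l with
    | nil => simpa [adWord] using hz
    | cons q l ih =>
      simp only [adWord, List.map_cons, List.prod_cons, Module.End.mul_apply] at ih ⊢
      exact hpow hf (hpow hg ih _) _
  simp only [bch_eq_sum]
  exact isVonNBounded_range_add hf (isVonNBounded_range_sum _ fun k _ =>
    isVonNBounded_range_sum _ fun p _ => isVonNBounded_range_sum _ fun m _ =>
      isVonNBounded_range_const_smul (key _ (hpow hf hg m)) _)

end Boundedness

end BCHAnalysis

/-! ### Continuity into the topology of uniform convergence on bounded sets. -/

section UniformConvergenceOnBoundedSets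

set_option linter.unusedSectionVars false

open scoped Pointwise

variable {𝕜 : Type*} [RCLike 𝕜] {E : Type*} [AddCommGroup E] [Module 𝕜 E] [TopologicalSpace E]

namespace ContFun

theorem tendsto_iff {ι : Type*} {l : Filter ι} {f : ι → ContFun 𝕜 E} {φ : ContFun 𝕜 E} :
    Tendsto f l (𝓝 φ) ↔ ∀ B : Set E, Bornology.IsVonNBounded 𝕜 B →
      TendstoUniformlyOn (fun i y => f i y) φ l B := by
  rw [(Topology.IsInducing.mk rfl : Topology.IsInducing (toUniformOn 𝕜 E)).tendsto_nhds_iff,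
    UniformOnFun.tendsto_iff_tendstoUniformlyOn]
  rfl

theorem continuous_eval [ContinuousSMul 𝕜 E] (y : E) : Continuous fun φ : ContFun 𝕜 E => φ y := by
  refine continuous_iff_continuousAt.mpr fun φ => ?_
  exact (tendsto_iff.mp tendsto_id {y} (Bornology.isVonNBounded_singleton y)).tendsto_at rfl

variable [IsTopologicalAddGroup E] [ContinuousSMul 𝕜 E] {Y : Type*} [AddCommGroup Y] [Module 𝕜 Y]
  [TopologicalSpace Y] [IsTopologicalAddGroup Y] [ContinuousSMul 𝕜 Y]

/-- Continuity bounds `h` near `(x₀, 0)` only. A bounded set lies in a multiple `s V` of a small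
balanced `V`, and interpolation extrapolates the bound from `V` to `s V`. -/
theorem exists_nhds_bound {D : ℕ} {h : Y × E → 𝕜} (hc : Continuous h) (hp : IsLinePoly 𝕜 D h)
    (x₀ : Y) {B : Set E} (hB : Bornology.IsVonNBounded 𝕜 B) :
    ∃ U ∈ 𝓝 (0 : Y), ∃ K : ℝ, ∀ u ∈ U, ∀ y ∈ B, ‖h (x₀ + u, y)‖ ≤ K := by
  have hcont : ContinuousAt (fun p : Y × E => ‖h (x₀ + p.1, p.2)‖) (0, 0) := by
    have : Continuous fun p : Y × E => ‖h (x₀ + p.1, p.2)‖ :=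
      (hc.comp ((continuous_const.add continuous_fst).prodMk continuous_snd)).norm
    exact this.continuousAt
  have hev := hcont.eventually_lt_const (lt_add_one _)
  rw [nhds_prod_eq] at hev
  obtain ⟨pU, hU, pV, hV, hUV⟩ := eventually_prod_iff.mp hev
  set K₀ := ‖h (x₀ + ((0 : Y), (0 : E)).1, ((0 : Y), (0 : E)).2)‖ + 1
  set V := balancedCore 𝕜 {v | pV v} with hVdef
  have hVn : V ∈ 𝓝 (0 : E) := balancedCore_mem_nhds_zero hV
  obtain ⟨r, hr, hBr⟩ := (hB hVn).exists_pos
  have hD : ((D : 𝕜) + 1) ≠ 0 := by exact_mod_cast D.succ_ne_zero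
  set s : 𝕜 := (r : 𝕜) with hs
  have hBs : B ⊆ s • V := hBr s (by simp [hs, abs_of_pos hr])
  refine ⟨{u | pU u}, hU, ∑ i ∈ Finset.range (D + 1),
    ‖(lagrangeNat 𝕜 D i).eval (s * (D + 1))‖ * K₀, fun u hu y hy => ?_⟩
  obtain ⟨v, hv, rfl⟩ := hBs hy
  -- Dividing the direction by `D + 1` keeps every node `i v / (D + 1)` in the balanced set `V`; the
  -- target `s v` is reached at time `s (D + 1)`.
  have hline := hp.apply_add_smul (x₀ + u, (0 : E)) ((0 : Y), ((D : 𝕜) + 1)⁻¹ • v) (s * (D + 1))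
  have e1 : ((x₀ + u, (0 : E)) + (s * (D + 1)) • ((0 : Y), ((D : 𝕜) + 1)⁻¹ • v) : Y × E)
      = (x₀ + u, s • v) := by
    ext
    · simp
    · simp [smul_smul, hD]
  rw [e1] at hline
  show ‖h (x₀ + u, s • v)‖ ≤ _
  rw [hline]
  refine (norm_sum_le _ _).trans (Finset.sum_le_sum fun i hi => ?_)
  rw [norm_smul]
  refine mul_le_mul_of_nonneg_left ?_ (norm_nonneg _)
  have e2 : ((x₀ + u, (0 : E)) + (i : 𝕜) • ((0 : Y), ((D : 𝕜) + 1)⁻¹ • v) : Y × E)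
      = (x₀ + u, ((i : 𝕜) * ((D : 𝕜) + 1)⁻¹) • v) := by
    ext
    · simp
    · simp [smul_smul]
  rw [e2]
  refine (hUV hu (balancedCore_subset _ (balancedCore_balanced _ |>.smul_mem ?_ hv))).le
  have hi : (i : ℝ) ≤ D + 1 := by exact_mod_cast (Finset.mem_range.mp hi).le
  have hD' : ‖((D : 𝕜) + 1)‖ = (D : ℝ) + 1 := by
    have := RCLike.norm_natCast (K := 𝕜) (D + 1)
    push_cast at this
    exact this
  rw [norm_mul, norm_inv, hD', RCLike.norm_natCast, ← div_eq_mul_inv]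
  exact (div_le_one (by positivity)).mpr hi

/-- A family of functions that is jointly continuous and polynomial along lines depends
continuously on its parameter, uniformly on bounded sets. -/
theorem continuous_of_isLinePoly {D : ℕ} {h : Y → ContFun 𝕜 E}
    (hc : Continuous fun p : Y × E => h p.1 p.2) (hp : IsLinePoly 𝕜 D fun p : Y × E => h p.1 p.2) :
    Continuous h := by
  refine continuous_iff_continuousAt.mpr fun x₀ => tendsto_iff.mpr fun B hB => ?_
  obtain ⟨U₀, hU₀, K, hK⟩ := exists_nhds_bound hc hp x₀ hB
  set U := balancedCore 𝕜 U₀ with hU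
  have hUn : U ∈ 𝓝 (0 : Y) := balancedCore_mem_nhds_zero hU₀
  have hD : ((D : 𝕜) + 1) ≠ 0 := by exact_mod_cast D.succ_ne_zero
  have hD' : ‖((D : 𝕜) + 1)‖ = (D : ℝ) + 1 := by
    have := RCLike.norm_natCast (K := 𝕜) (D + 1)
    push_cast at this
    exact this
  rw [Metric.tendstoUniformlyOn_iff]
  intro ε hε
  have hcont : Continuous fun t : 𝕜 => ∑ i ∈ Finset.range (D + 1),
      ‖(lagrangeNat 𝕜 D i).eval (t * (D + 1)) - (lagrangeNat 𝕜 D i).eval 0‖ * K :=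
    continuous_finsetSum _ fun i _ => (((lagrangeNat 𝕜 D i).continuous.comp
      (continuous_id.mul continuous_const)).sub continuous_const).norm.mul continuous_const
  have hev := (hcont.tendsto 0).eventually_lt_const (u := ε) (by simpa using hε)
  -- For `x = x₀ + τ u` both `h x y` and `h x₀ y` are interpolated from the same node values,
  -- bounded by `K` uniformly in `y ∈ B`; only the Lagrange weights differ, and a small nonzero `τ`
  -- makes that difference small. Since `τ ≠ 0`, `τ • U` is still a neighbourhood of `0`.
  obtain ⟨τ, hτε, hτ0⟩ : ∃ τ : 𝕜, (∑ i ∈ Finset.range (D + 1),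
      ‖(lagrangeNat 𝕜 D i).eval (τ * (D + 1)) - (lagrangeNat 𝕜 D i).eval 0‖ * K) < ε ∧ τ ≠ 0 :=
    ((hev.filter_mono nhdsWithin_le_nhds).and
      (self_mem_nhdsWithin : {0}ᶜ ∈ 𝓝[≠] (0 : 𝕜))).exists
  have hτU : τ • U ∈ 𝓝 (0 : Y) := by
    simpa using (smul_mem_nhds_smul_iff₀ hτ0).mpr hUn
  have hnhds : ∀ᶠ x in 𝓝 x₀, x - x₀ ∈ τ • U := by
    have : Tendsto (fun x => x - x₀) (𝓝 x₀) (𝓝 0) := by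
      have h' : Continuous fun x : Y => x - x₀ := continuous_id.sub continuous_const
      simpa using h'.tendsto x₀
    exact this hτU
  filter_upwards [hnhds] with x hx y hy
  obtain ⟨u, hu, hux⟩ := hx
  have hux : τ • u = x - x₀ := hux
  have hxu : x = x₀ + τ • u := by rw [hux]; abel
  have hnode : ∀ i ∈ Finset.range (D + 1),
      ‖h (x₀ + ((i : 𝕜) * ((D : 𝕜) + 1)⁻¹) • u) y‖ ≤ K := by
    intro i hi
    refine hK _ (balancedCore_subset _ (balancedCore_balanced _ |>.smul_mem ?_ hu)) y hy
    have hi : (i : ℝ) ≤ D + 1 := by exact_mod_cast (Finset.mem_range.mp hi).le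
    rw [norm_mul, norm_inv, hD', RCLike.norm_natCast, ← div_eq_mul_inv]
    exact (div_le_one (by positivity)).mpr hi
  have hline : ∀ t : 𝕜, h (x₀ + (t * ((D : 𝕜) + 1)⁻¹) • u) y = ∑ i ∈ Finset.range (D + 1),
      (lagrangeNat 𝕜 D i).eval t * h (x₀ + ((i : 𝕜) * ((D : 𝕜) + 1)⁻¹) • u) y := by
    intro t
    have := hp.apply_add_smul (x₀, y) (((D : 𝕜) + 1)⁻¹ • u, (0 : E)) t
    simpa [smul_smul] using this
  have h1 : h x y = ∑ i ∈ Finset.range (D + 1), (lagrangeNat 𝕜 D i).eval (τ * (D + 1)) *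
      h (x₀ + ((i : 𝕜) * ((D : 𝕜) + 1)⁻¹) • u) y := by
    rw [← hline, hxu, mul_assoc, mul_inv_cancel₀ hD, mul_one]
  have h0 : h x₀ y = ∑ i ∈ Finset.range (D + 1), (lagrangeNat 𝕜 D i).eval 0 *
      h (x₀ + ((i : 𝕜) * ((D : 𝕜) + 1)⁻¹) • u) y := by
    rw [← hline, zero_mul, zero_smul, add_zero]
  rw [dist_comm, dist_eq_norm, h1, h0, ← Finset.sum_sub_distrib]
  refine lt_of_le_of_lt ((norm_sum_le _ _).trans (Finset.sum_le_sum fun i hi => ?_)) hτε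
  rw [← sub_mul, norm_mul]
  exact mul_le_mul_of_nonneg_left (hnode i hi) (norm_nonneg _)

end ContFun

end UniformConvergenceOnBoundedSets

theorem ContFun.ext {𝕜 : Type*} [RCLike 𝕜] {E : Type*} [TopologicalSpace E] {φ ψ : ContFun 𝕜 E}
    (h : ∀ y, φ y = ψ y) : φ = ψ :=
  DFunLike.ext (F := ContFun 𝕜 E) φ ψ h

theorem exists_functional_ne (𝕜 : Type*) [RCLike 𝕜] {E : Type*} [AddCommGroup E] [Module 𝕜 E]
    [TopologicalSpace E] [IsTopologicalAddGroup E] [ContinuousSMul 𝕜 E] [Module ℝ E]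
    [IsScalarTower ℝ 𝕜 E] [LocallyConvexSpace ℝ E] [T2Space E] {x y : E} (h : x ≠ y) :
    ∃ ξ : E →L[𝕜] 𝕜, ξ x ≠ ξ y := by
  have : ContinuousSMul ℝ E := IsScalarTower.continuousSMul 𝕜
  obtain ⟨ξ, hξ⟩ := RCLike.geometric_hahn_banach_point_point (𝕜 := 𝕜) h
  exact ⟨ξ, fun h => by simp [h] at hξ⟩

/-! ### The space `FG`: invariance, polynomial degree, constants. -/

section ClosedSpan

variable {𝕜 : Type*} [RCLike 𝕜] {𝔤 : Type*} [LieRing 𝔤] [LieAlgebra 𝕜 𝔤]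

theorem bch_neg_neg {N : ℕ} (V : LieFiltration 𝕜 𝔤 N) (hN : 1 ≤ N) (x y : 𝔤) :
    bch 𝕜 N (-y) (-x) = -bch 𝕜 N x y := by
  let _ := bchGroup V hN
  exact (mul_inv_rev x y).symm

theorem bch_neg_bch_neg {N : ℕ} (V : LieFiltration 𝕜 𝔤 N) (hN : 1 ≤ N) (x y z : 𝔤) :
    bch 𝕜 N (-y) (bch 𝕜 N (-x) z) = bch 𝕜 N (-bch 𝕜 N x y) z := by
  rw [← bch_neg_neg V hN, bch_assoc V hN]

theorem bch_smul_smul {N : ℕ} (hN : 1 ≤ N) (s t : 𝕜) (x : 𝔤) :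
    bch 𝕜 N (s • x) (t • x) = (s + t) • x := by
  rw [bch_of_lie_eq_zero hN (by simp), add_smul]

theorem flow_add {N : ℕ} (V : LieFiltration 𝕜 𝔤 N) (hN : 1 ≤ N) (s t : 𝕜) (x y : 𝔤) :
    bch 𝕜 N (-(s • x)) (bch 𝕜 N (-(t • x)) y) = bch 𝕜 N (-((t + s) • x)) y := by
  rw [bch_neg_bch_neg V hN, bch_smul_smul hN]

theorem bch_zero_left {N : ℕ} (hN : 1 ≤ N) (x : 𝔤) : bch 𝕜 N 0 x = x := by
  rw [bch_of_lie_eq_zero hN (zero_lie x), zero_add]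

theorem bch_zero_right {N : ℕ} (hN : 1 ≤ N) (x : 𝔤) : bch 𝕜 N x 0 = x := by
  rw [bch_of_lie_eq_zero hN (lie_zero x), add_zero]

variable [TopologicalSpace 𝔤] [IsTopologicalAddGroup 𝔤] [ContinuousSMul 𝕜 𝔤]
  [ContinuousLieBracket 𝔤]

theorem leftReg_apply (N : ℕ) (x : 𝔤) (φ : ContFun 𝕜 𝔤) (y : 𝔤) :
    leftReg 𝕜 N x φ y = φ (bch 𝕜 N (-x) y) := rfl

/-- Left translation maps bounded sets to bounded sets, so precomposing with it preserves uniform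
convergence on them. -/
theorem continuous_leftReg (N : ℕ) (x : 𝔤) : Continuous (leftReg 𝕜 N x) := by
  refine continuous_iff_continuousAt.mpr fun φ => ContFun.tendsto_iff.mpr fun B hB => ?_
  have hb : Bornology.IsVonNBounded 𝕜 (Set.range fun y : B => bch 𝕜 N (-x) (y : 𝔤)) := by
    refine isVonNBounded_range_bch (f := fun _ : B => -x)
      ((Bornology.isVonNBounded_singleton (-x)).subset ?_) (by simpa using hB) N
    rintro _ ⟨_, rfl⟩
    rfl
  refine ((ContFun.tendsto_iff.mp tendsto_id _ hb).comp (bch 𝕜 N (-x))).mono fun y hy => ?_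
  exact ⟨⟨y, hy⟩, rfl⟩

theorem leftReg_bch {N : ℕ} (V : LieFiltration 𝕜 𝔤 N) (hN : 1 ≤ N) (x y : 𝔤) (φ : ContFun 𝕜 𝔤) :
    leftReg 𝕜 N (bch 𝕜 N x y) φ = leftReg 𝕜 N x (leftReg 𝕜 N y φ) :=
  ContFun.ext fun z => by simp only [leftReg_apply, bch_neg_bch_neg V hN]

theorem leftReg_functional_mem_FG (N : ℕ) (x : 𝔤) (ξ : 𝔤 →L[𝕜] 𝕜) :
    leftReg 𝕜 N x (ContFun.mk ξ ξ.continuous) ∈ FG 𝕜 𝔤 N :=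
  Submodule.le_topologicalClosure _ (Submodule.subset_span ⟨x, ξ, rfl⟩)

theorem leftReg_mem_FG {N : ℕ} (V : LieFiltration 𝕜 𝔤 N) (hN : 1 ≤ N) (x : 𝔤) {φ : ContFun 𝕜 𝔤}
    (hφ : φ ∈ FG 𝕜 𝔤 N) : leftReg 𝕜 N x φ ∈ FG 𝕜 𝔤 N := by
  have hclosed : IsClosed ((FG 𝕜 𝔤 N).comap (leftReg 𝕜 N x) : Set (ContFun 𝕜 𝔤)) :=
    (Submodule.isClosed_topologicalClosure _).preimage (continuous_leftReg N x)
  refine (Submodule.topologicalClosure_minimal _ (Submodule.span_le.mpr ?_) hclosed) hφ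
  rintro _ ⟨y, ξ, rfl⟩
  rw [SetLike.mem_coe, Submodule.mem_comap, ← leftReg_bch V hN]
  exact leftReg_functional_mem_FG N _ ξ

theorem functional_mem_FG {N : ℕ} (hN : 1 ≤ N) (ξ : 𝔤 →L[𝕜] 𝕜) :
    ContFun.mk ξ ξ.continuous ∈ FG 𝕜 𝔤 N := by
  convert leftReg_functional_mem_FG N 0 ξ using 1
  exact ContFun.ext fun y => by simp [leftReg_apply, bch_zero_left hN]

/-- On the generators the degree comes from `bch` alone, as functionals are linear; the
interpolation equations involve only point evaluations, which are continuous, so they pass to the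
closed span. -/
theorem comp_mem_polyCurve_of_mem_FG {N : ℕ} (V : LieFiltration 𝕜 𝔤 N) (hN : 1 ≤ N)
    {φ : ContFun 𝕜 𝔤} (hφ : φ ∈ FG 𝕜 𝔤 N) {n : ℕ} {c : 𝕜 → 𝔤} (hc : c ∈ polyCurve 𝕜 𝔤 n) :
    (fun t => φ (c t)) ∈ polyCurve 𝕜 𝕜 (N * n) := by
  let S : Submodule 𝕜 (ContFun 𝕜 𝔤) :=
    { carrier := {φ | (fun t => φ (c t)) ∈ polyCurve 𝕜 𝕜 (N * n)}
      add_mem' := fun ha hb => (polyCurve 𝕜 𝕜 (N * n)).add_mem ha hb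
      zero_mem' := (polyCurve 𝕜 𝕜 (N * n)).zero_mem
      smul_mem' := fun a _ h => (polyCurve 𝕜 𝕜 (N * n)).smul_mem a h }
  refine (Submodule.topologicalClosure_minimal (t := S) _ (Submodule.span_le.mpr ?_) ?_) hφ
  · rintro _ ⟨x, ξ, rfl⟩
    have h := bch_mem_polyCurve V hN (const_mem_polyCurve (𝕜 := 𝕜) n (-x)) hc
    exact map_mem_polyCurve ξ.toLinearMap h
  · have : (S : Set (ContFun 𝕜 𝔤)) = ⋂ t : 𝕜, {φ | φ (c t) = ∑ i ∈ Finset.range (N * n + 1),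
        (lagrangeNat 𝕜 (N * n) i).eval t • φ (c i)} := by
      ext φ
      simp only [Set.mem_iInter]
      exact mem_polyCurve_iff
    rw [this]
    exact isClosed_iInter fun t => isClosed_eq (ContFun.continuous_eval _)
      (continuous_finsetSum _ fun i _ => continuous_const.mul (ContFun.continuous_eval (c i)))

theorem FG_le_contPoly {N : ℕ} (V : LieFiltration 𝕜 𝔤 N) (hN : 1 ≤ N) :
    FG 𝕜 𝔤 N ≤ ContPoly 𝕜 𝔤 N := fun φ hφ =>
  mem_contPoly_of_isLinePoly fun x v => by
    simpa using comp_mem_polyCurve_of_mem_FG V hN hφ (line_mem_polyCurve x v)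

/-- One factor `N` is the degree of `bch` along a line, the other that of `φ`. -/
theorem isLinePoly_bch_of_mem_FG {N : ℕ} (V : LieFiltration 𝕜 𝔤 N) (hN : 1 ≤ N)
    {φ : ContFun 𝕜 𝔤} (hφ : φ ∈ FG 𝕜 𝔤 N) :
    IsLinePoly 𝕜 (N * N) fun p : 𝔤 × 𝔤 => φ (bch 𝕜 N (-p.1) p.2) := by
  intro p q
  have h1 : (fun t : 𝕜 => -(p.1 + t • q.1)) ∈ polyCurve 𝕜 𝔤 1 :=
    Submodule.neg_mem _ (line_mem_polyCurve p.1 q.1)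
  simpa using! comp_mem_polyCurve_of_mem_FG V hN hφ
    (bch_mem_polyCurve V hN h1 (line_mem_polyCurve p.2 q.2))

/-- Translation by a central `z` is ordinary translation, so `ξ - λ(z) ξ` is the constant `ξ z`,
which is nonzero for a suitable `ξ`. -/
theorem const_mem_FG [Module ℝ 𝔤] [IsScalarTower ℝ 𝕜 𝔤] [LocallyConvexSpace ℝ 𝔤] [T2Space 𝔤]
    {N : ℕ} (hN : 1 ≤ N) {z : 𝔤} (hz : z ≠ 0) (hcomm : ∀ y : 𝔤, ⁅z, y⁆ = 0) (a : 𝕜) :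
    ContFun.mk (fun _ : 𝔤 => a) continuous_const ∈ FG 𝕜 𝔤 N := by
  obtain ⟨ξ, hξ⟩ := exists_functional_ne 𝕜 hz
  rw [map_zero] at hξ
  have h := Submodule.smul_mem _ (a / ξ z)
    (Submodule.add_mem _ (functional_mem_FG hN ξ)
      (Submodule.smul_mem _ (-1) (leftReg_functional_mem_FG N z ξ)))
  convert h using 1
  refine ContFun.ext fun y => ?_
  rw [ContFun.smul_apply, ContFun.add_apply, ContFun.smul_apply, leftReg_apply,
    bch_of_lie_eq_zero hN (by rw [neg_lie, hcomm, neg_zero])]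
  simp [hξ]

end ClosedSpan

/-! ### The group representation and its derived Lie algebra representation. -/

section Representation

open Polynomial

variable {𝕜 : Type v} [RCLike 𝕜] {𝔤 : Type u} [LieRing 𝔤] [LieAlgebra 𝕜 𝔤] [TopologicalSpace 𝔤]
  [IsTopologicalAddGroup 𝔤] [ContinuousSMul 𝕜 𝔤] [ContinuousLieBracket 𝔤] {N : ℕ}

/-- The operator `λ(x)` on `F_G`. -/
noncomputable def lamFG (V : LieFiltration 𝕜 𝔤 N) (hN : 1 ≤ N) (x : 𝔤) :
    FG 𝕜 𝔤 N →L[𝕜] FG 𝕜 𝔤 N where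
  toLinearMap := (leftReg 𝕜 N x).restrict fun _ => leftReg_mem_FG V hN x
  cont := ((continuous_leftReg N x).comp continuous_subtype_val).subtype_mk _

theorem FG_ext {φ ψ : FG 𝕜 𝔤 N} (h : ∀ y, (φ : ContFun 𝕜 𝔤) y = (ψ : ContFun 𝕜 𝔤) y) : φ = ψ :=
  Subtype.ext (ContFun.ext h)

/-- Evaluation at a point, as a linear form on `F_G`. -/
def evalFG (𝕜 : Type v) [RCLike 𝕜] {𝔤 : Type u} [LieRing 𝔤] [LieAlgebra 𝕜 𝔤] [TopologicalSpace 𝔤]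
    [IsTopologicalAddGroup 𝔤] [ContinuousSMul 𝕜 𝔤] [ContinuousLieBracket 𝔤] (N : ℕ) (y : 𝔤) :
    FG 𝕜 𝔤 N →ₗ[𝕜] 𝕜 where
  toFun φ := (φ : ContFun 𝕜 𝔤) y
  map_add' _ _ := rfl
  map_smul' _ _ := rfl

theorem evalFG_apply (φ : FG 𝕜 𝔤 N) (y : 𝔤) : evalFG 𝕜 N y φ = (φ : ContFun 𝕜 𝔤) y := rfl

theorem lamFG_apply (V : LieFiltration 𝕜 𝔤 N) (hN : 1 ≤ N) (x : 𝔤) (φ : FG 𝕜 𝔤 N) (y : 𝔤) :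
    (lamFG V hN x φ : ContFun 𝕜 𝔤) y = (φ : ContFun 𝕜 𝔤) (bch 𝕜 N (-x) y) := rfl

theorem lamFG_bch (V : LieFiltration 𝕜 𝔤 N) (hN : 1 ≤ N) (x y : 𝔤) :
    lamFG V hN (bch 𝕜 N x y) = lamFG V hN x * lamFG V hN y :=
  ContinuousLinearMap.ext fun φ => Subtype.ext (leftReg_bch V hN x y φ)

theorem lamFG_zero (V : LieFiltration 𝕜 𝔤 N) (hN : 1 ≤ N) : lamFG V hN 0 = 1 :=
  ContinuousLinearMap.ext fun φ => FG_ext fun y => by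
    rw [lamFG_apply, neg_zero, bch_zero_left hN]; rfl

theorem isLinePoly_FG_of_eval {E : Type*} [AddCommGroup E] [Module 𝕜 E] {D : ℕ}
    {f : E → FG 𝕜 𝔤 N} (h : ∀ y, IsLinePoly 𝕜 D fun x => (f x : ContFun 𝕜 𝔤) y) :
    IsLinePoly 𝕜 D f := fun x v => mem_polyCurve_iff.mpr fun t => FG_ext fun y => by
  rw [(h y).apply_add_smul x v t, ← evalFG_apply (∑ i ∈ _, _), map_sum]
  simp only [map_smul, evalFG_apply]

theorem isLinePoly_lamFG_eval (V : LieFiltration 𝕜 𝔤 N) (hN : 1 ≤ N) (φ : FG 𝕜 𝔤 N) (y : 𝔤) :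
    IsLinePoly 𝕜 (N * N) fun x => (lamFG V hN x φ : ContFun 𝕜 𝔤) y := by
  have := (isLinePoly_bch_of_mem_FG V hN φ.2).comp_linear (LinearMap.inl 𝕜 𝔤 𝔤) (0, y)
  simpa [lamFG_apply] using this

theorem isLinePoly_lamFG (V : LieFiltration 𝕜 𝔤 N) (hN : 1 ≤ N) (φ : FG 𝕜 𝔤 N) :
    IsLinePoly 𝕜 (N * N) fun x => lamFG V hN x φ :=
  isLinePoly_FG_of_eval (isLinePoly_lamFG_eval V hN φ)

theorem continuous_lamFG (V : LieFiltration 𝕜 𝔤 N) (hN : 1 ≤ N) (φ : FG 𝕜 𝔤 N) :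
    Continuous fun x => lamFG V hN x φ := by
  have h : Continuous fun x => leftReg 𝕜 N x (φ : ContFun 𝕜 𝔤) :=
    ContFun.continuous_of_isLinePoly
      ((φ : ContFun 𝕜 𝔤).continuous.comp (continuous_fst.neg.bch continuous_snd N))
      (isLinePoly_bch_of_mem_FG V hN φ.2)
  exact continuous_induced_rng.mpr h

/-- `(t, y) ↦ t φ(y)` is jointly continuous and polynomial along lines. This supplies the scalar
continuity needed to differentiate in `FG`. -/
theorem continuous_smul_FG (V : LieFiltration 𝕜 𝔤 N) (hN : 1 ≤ N) (φ : FG 𝕜 𝔤 N) :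
    Continuous fun t : 𝕜 => t • φ := by
  refine Continuous.subtype_mk (ContFun.continuous_of_isLinePoly (D := 1 + N * 1)
    (h := fun t : 𝕜 => t • (φ : ContFun 𝕜 𝔤))
    (continuous_fst.mul ((φ : ContFun 𝕜 𝔤).continuous.comp continuous_snd)) fun p q => ?_) _
  exact map₂_mem_polyCurve (LinearMap.mul 𝕜 𝕜) (line_mem_polyCurve p.1 q.1)
    (comp_mem_polyCurve_of_mem_FG V hN φ.2 (line_mem_polyCurve p.2 q.2))

theorem isSmoothMap_lamFG (V : LieFiltration 𝕜 𝔤 N) (hN : 1 ≤ N) (φ : FG 𝕜 𝔤 N) :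
    IsSmoothMap 𝕜 fun x => lamFG V hN x φ := fun k =>
  (isLinePoly_lamFG V hN φ).isCk (continuous_smul_FG V hN) k 𝔤 (continuous_lamFG V hN φ)

theorem lamFG_injective [Module ℝ 𝔤] [IsScalarTower ℝ 𝕜 𝔤] [LocallyConvexSpace ℝ 𝔤] [T2Space 𝔤]
    (V : LieFiltration 𝕜 𝔤 N) (hN : 1 ≤ N) : Function.Injective (lamFG V hN) := by
  intro x y h
  by_contra hne
  obtain ⟨ξ, hξ⟩ := exists_functional_ne 𝕜 hne
  have := congrArg (fun T : FG 𝕜 𝔤 N →L[𝕜] FG 𝕜 𝔤 N =>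
    (T ⟨_, functional_mem_FG hN ξ⟩ : ContFun 𝕜 𝔤) 0) h
  simp only [lamFG_apply, bch_zero_right hN, ContFun.mk_apply, map_neg, neg_inj] at this
  exact hξ this

/-- The value of `φ ∈ F_G` along the flow of `x` through `y` is a polynomial of the time. -/
theorem exists_flow_polynomial (V : LieFiltration 𝕜 𝔤 N) (hN : 1 ≤ N) (φ : FG 𝕜 𝔤 N) (x y : 𝔤) :
    ∃ P : 𝕜[X], P.natDegree ≤ N * N ∧
      ∀ t : 𝕜, (φ : ContFun 𝕜 𝔤) (bch 𝕜 N (-(t • x)) y) = P.eval t := by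
  have := exists_polynomial_of_mem_polyCurve (isLinePoly_lamFG_eval V hN φ y 0 x)
  simpa [lamFG_apply] using this

/-- Along the flow of `x`, `λ(x)` shifts time by `1`, so `λ(x) - 1` is the forward difference. -/
theorem lamFG_sub_one_pow_eval (V : LieFiltration 𝕜 𝔤 N) (hN : 1 ≤ N) (φ : FG 𝕜 𝔤 N) (x y : 𝔤)
    {f : 𝕜 → 𝕜} (hf : ∀ t : 𝕜, (φ : ContFun 𝕜 𝔤) (bch 𝕜 N (-(t • x)) y) = f t) (n : ℕ) (t : 𝕜) :
    (((lamFG V hN x - 1) ^ n) φ : ContFun 𝕜 𝔤) (bch 𝕜 N (-(t • x)) y) = ((fwdDiff 1)^[n] f) t := by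
  induction n generalizing t with
  | zero => simpa using hf t
  | succ n ih =>
    rw [pow_succ', mul_apply_eq_comp, Function.iterate_succ_apply', fwdDiff, ← ih, ← ih,
      ← flow_add V hN 1 t x y, one_smul]
    set ψ := ((lamFG V hN x - 1) ^ n) φ
    rw [sub_apply, one_apply_eq_self, ← evalFG_apply (_ - _),
      map_sub]
    rfl

theorem lamFG_sub_one_pow_eq_zero (V : LieFiltration 𝕜 𝔤 N) (hN : 1 ≤ N) {n : ℕ}
    (hn : N * N < n) (x : 𝔤) : (lamFG V hN x - 1) ^ n = 0 := by
  refine ContinuousLinearMap.ext fun φ => FG_ext fun y => ?_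
  obtain ⟨P, hP, hPe⟩ := exists_flow_polynomial V hN φ x y
  have := lamFG_sub_one_pow_eval V hN φ x y (f := P.eval) hPe n 0
  rw [fwdDiff_iter_eq_zero_of_degree_lt (hP.trans_lt hn), zero_smul, neg_zero, bch_zero_left hN]
    at this
  exact this

/-- The operator `λ̇(x)` on `F_G`, as a linear function of `x`. -/
noncomputable def dlamFG (V : LieFiltration 𝕜 𝔤 N) (hN : 1 ≤ N) :
    𝔤 →ₗ[𝕜] (FG 𝕜 𝔤 N →L[𝕜] FG 𝕜 𝔤 N) where
  -- The derivative at `0` of `t ↦ λ(tx)`, computed by exact numerical differentiation; this form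
  -- makes continuity of the operator and invariance of `FG` automatic.
  toFun x := ∑ i ∈ Finset.range (N * N + 1), diffWeight 𝕜 (N * N) i • lamFG V hN ((i : 𝕜) • x)
  map_add' x x' := ContinuousLinearMap.ext fun φ => FG_ext fun y => by
    have h := (isLinePoly_lamFG_eval V hN φ y).lineDer_add x x' 0
    simp only [lineDer, zero_add] at h
    simp only [← evalFG_apply, add_apply, sum_apply,
      smul_apply, map_add, map_sum, map_smul] at h ⊢
    exact h
  map_smul' a x := ContinuousLinearMap.ext fun φ => FG_ext fun y => by
    have h := (isLinePoly_lamFG_eval V hN φ y).lineDer_smul a x 0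
    simp only [lineDer, zero_add] at h
    simp only [← evalFG_apply, sum_apply, RingHom.id_apply,
      smul_apply, map_sum, map_smul] at h ⊢
    exact h

theorem dlamFG_eq (V : LieFiltration 𝕜 𝔤 N) (hN : 1 ≤ N) (x : 𝔤) : dlamFG V hN x =
    ∑ i ∈ Finset.range (N * N + 1), diffWeight 𝕜 (N * N) i • lamFG V hN ((i : 𝕜) • x) := rfl

theorem dlamFG_apply (V : LieFiltration 𝕜 𝔤 N) (hN : 1 ≤ N) (x : 𝔤) (φ : FG 𝕜 𝔤 N) (y : 𝔤) :
    (dlamFG V hN x φ : ContFun 𝕜 𝔤) y = ∑ i ∈ Finset.range (N * N + 1),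
      diffWeight 𝕜 (N * N) i • (φ : ContFun 𝕜 𝔤) (bch 𝕜 N (-((i : 𝕜) • x)) y) := by
  simp only [← evalFG_apply, dlamFG_eq, sum_apply,
    smul_apply, map_sum, map_smul]
  rfl

theorem tendsto_slope_lamFG (V : LieFiltration 𝕜 𝔤 N) (hN : 1 ≤ N) (x : 𝔤) (φ : FG 𝕜 𝔤 N) :
    Tendsto (fun t : 𝕜 => t⁻¹ • (lamFG V hN (t • x) φ - φ)) (𝓝[≠] 0) (𝓝 (dlamFG V hN x φ)) := by
  have h := tendsto_slope_polyCurve (continuous_smul_FG V hN) (isLinePoly_lamFG V hN φ 0 x)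
  simp only [zero_add, zero_smul, lamFG_zero, one_apply_eq_self] at h
  simpa only [dlamFG_eq, sum_apply, smul_apply] using h

theorem hasDerivAt_flow (V : LieFiltration 𝕜 𝔤 N) (hN : 1 ≤ N) (x : 𝔤) (φ : FG 𝕜 𝔤 N) (y : 𝔤) :
    HasDerivAt (fun t : 𝕜 => (φ : ContFun 𝕜 𝔤) (bch 𝕜 N (-(t • x)) y))
      ((dlamFG V hN x φ : ContFun 𝕜 𝔤) y) 0 := by
  have h := (isLinePoly_lamFG_eval V hN φ y).hasDerivAt 0 x
  simpa only [lineDer, zero_add, lamFG_apply, dlamFG_apply] using h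

theorem isLambdaDot_dlamFG (V : LieFiltration 𝕜 𝔤 N) (hN : 1 ≤ N) (x : 𝔤) (φ : FG 𝕜 𝔤 N) :
    IsLambdaDot 𝕜 N x φ (dlamFG V hN x φ : ContFun 𝕜 𝔤) := fun y => by
  have h := hasDerivAt_iff_tendsto_slope_zero.mp (hasDerivAt_flow V hN x φ y)
  simp only [zero_add, zero_smul, neg_zero, bch_zero_left hN] at h
  refine h.congr fun t => ?_
  rw [smul_eq_mul, div_eq_inv_mul]

theorem dlamFG_injective [Module ℝ 𝔤] [IsScalarTower ℝ 𝕜 𝔤] [LocallyConvexSpace ℝ 𝔤] [T2Space 𝔤]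
    (V : LieFiltration 𝕜 𝔤 N) (hN : 1 ≤ N) : Function.Injective (dlamFG V hN) := by
  intro x y h
  by_contra hne
  obtain ⟨ξ, hξ⟩ := exists_functional_ne 𝕜 hne
  have hval : ∀ z : 𝔤, (dlamFG V hN z ⟨_, functional_mem_FG hN ξ⟩ : ContFun 𝕜 𝔤) 0 = -ξ z := by
    intro z
    refine (hasDerivAt_flow V hN z ⟨_, functional_mem_FG hN ξ⟩ 0).unique ?_
    simp only [bch_zero_right hN, ContFun.mk_apply, map_neg, map_smul, smul_eq_mul]
    simpa using ((hasDerivAt_id (0 : 𝕜)).mul_const (ξ z)).fun_neg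
  have := hval x
  rw [h, hval y, neg_inj] at this
  exact hξ this.symm

theorem dlamFG_flow (V : LieFiltration 𝕜 𝔤 N) (hN : 1 ≤ N) (φ : FG 𝕜 𝔤 N) (x y : 𝔤) {P : 𝕜[X]}
    (hP : ∀ t : 𝕜, (φ : ContFun 𝕜 𝔤) (bch 𝕜 N (-(t • x)) y) = P.eval t) (t : 𝕜) :
    (dlamFG V hN x φ : ContFun 𝕜 𝔤) (bch 𝕜 N (-(t • x)) y) = (derivative P).eval t := by
  refine (hasDerivAt_flow V hN x φ _).unique ?_
  simp only [flow_add V hN, hP]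
  have h : HasDerivAt (fun s => P.eval s) ((derivative P).eval t) (t + 0) := by
    rw [add_zero]; exact P.hasDerivAt t
  exact h.comp_const_add t 0

theorem dlamFG_pow_flow (V : LieFiltration 𝕜 𝔤 N) (hN : 1 ≤ N) (φ : FG 𝕜 𝔤 N) (x y : 𝔤)
    {P : 𝕜[X]} (hP : ∀ t : 𝕜, (φ : ContFun 𝕜 𝔤) (bch 𝕜 N (-(t • x)) y) = P.eval t) (n : ℕ) (t : 𝕜) :
    ((dlamFG V hN x ^ n) φ : ContFun 𝕜 𝔤) (bch 𝕜 N (-(t • x)) y) = (derivative^[n] P).eval t := by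
  induction n generalizing t with
  | zero => simpa using hP t
  | succ n ih =>
    rw [pow_succ', mul_apply_eq_comp, Function.iterate_succ_apply',
      dlamFG_flow V hN _ x y ih]

theorem dlamFG_pow_eq_zero (V : LieFiltration 𝕜 𝔤 N) (hN : 1 ≤ N) {n : ℕ} (hn : N * N < n)
    (x : 𝔤) : dlamFG V hN x ^ n = 0 := by
  refine ContinuousLinearMap.ext fun φ => FG_ext fun y => ?_
  obtain ⟨P, hP, hPe⟩ := exists_flow_polynomial V hN φ x y
  have := dlamFG_pow_flow V hN φ x y hPe n 0
  rw [iterate_derivative_eq_zero (hP.trans_lt hn), zero_smul, neg_zero, bch_zero_left hN,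
    eval_zero] at this
  exact this

/-- The conjugation formula `x ∗ (s y) ∗ (-x) = s e^{ad x} y` gives the relation for every `λ(s y)`,
hence for the combination of them that defines `λ̇(y)`. -/
theorem lamFG_mul_dlamFG (V : LieFiltration 𝕜 𝔤 N) (hN : 1 ≤ N) (x y : 𝔤) :
    lamFG V hN x * dlamFG V hN y
      = dlamFG V hN (expAd 𝕜 (2 * (N + 1) + 1) x y) * lamFG V hN x := by
  have hconj : ∀ s : 𝕜, lamFG V hN x * lamFG V hN (s • y)
      = lamFG V hN (s • expAd 𝕜 (2 * (N + 1) + 1) x y) * lamFG V hN x := by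
    intro s
    have e : s • expAd 𝕜 (2 * (N + 1) + 1) x y = expAd 𝕜 (2 * (N + 1) + 1) x (s • y) := by
      simp only [expAd, Finset.smul_sum, map_smul]
      exact Finset.sum_congr rfl fun n _ => smul_comm _ _ _
    rw [e, ← bch_conj V hN, ← lamFG_bch, ← lamFG_bch, bch_assoc V hN,
      bch_of_lie_eq_zero hN (x := -x) (y := x) (by simp), neg_add_cancel, bch_zero_right hN]
  refine ContinuousLinearMap.ext fun φ => ?_
  simp only [dlamFG_eq, mul_apply_eq_comp, sum_apply, smul_apply, map_sum, map_smul]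
  exact Finset.sum_congr rfl fun i _ => congrArg _ (DFunLike.congr_fun (hconj i) φ)

/-- Differentiating `λ(tx) λ̇(y) = λ̇(e^{t ad x} y) λ(tx)` at `t = 0` gives `λ̇(x) λ̇(y) = λ̇(⁅x,
y⁆) + λ̇(y) λ̇(x)`. The computation is made at a point `p`, where all derivatives are scalar. -/
theorem dlamFG_lie (V : LieFiltration 𝕜 𝔤 N) (hN : 1 ≤ N) (x y : 𝔤) :
    dlamFG V hN ⁅x, y⁆ = dlamFG V hN x * dlamFG V hN y - dlamFG V hN y * dlamFG V hN x := by
  refine ContinuousLinearMap.ext fun φ => FG_ext fun p => ?_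
  have hflow : ∀ z : 𝔤, HasDerivAt
      (fun t : 𝕜 => (dlamFG V hN z (lamFG V hN (t • x) φ) : ContFun 𝕜 𝔤) p)
      ((dlamFG V hN z (dlamFG V hN x φ) : ContFun 𝕜 𝔤) p) 0 := by
    intro z
    simp only [dlamFG_apply V hN z]
    exact HasDerivAt.fun_sum fun i _ => (hasDerivAt_flow V hN x φ _).fun_const_smul _
  have hleft := hasDerivAt_flow V hN x (dlamFG V hN y φ) p
  have hexp : ∀ t : 𝕜, (dlamFG V hN y φ : ContFun 𝕜 𝔤) (bch 𝕜 N (-(t • x)) p)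
      = ∑ n ∈ Finset.range (2 * (N + 1) + 1), (((n.factorial : 𝕜)⁻¹ * t ^ n) *
        (dlamFG V hN ((LieAlgebra.ad 𝕜 𝔤 x ^ n) y) (lamFG V hN (t • x) φ) : ContFun 𝕜 𝔤) p) := by
    intro t
    have h := congrArg (fun T : FG 𝕜 𝔤 N →L[𝕜] FG 𝕜 𝔤 N => evalFG 𝕜 N p (T φ))
      (lamFG_mul_dlamFG V hN (t • x) y)
    simp only [mul_apply_eq_comp, expAd, map_sum, map_smul, _root_.smul_pow,
      LinearMap.smul_apply, sum_apply, smul_apply,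
      smul_smul, smul_eq_mul] at h
    exact h
  have hright : HasDerivAt (fun t : 𝕜 => ∑ n ∈ Finset.range (2 * (N + 1) + 1),
      (((n.factorial : 𝕜)⁻¹ * t ^ n) *
        (dlamFG V hN ((LieAlgebra.ad 𝕜 𝔤 x ^ n) y) (lamFG V hN (t • x) φ) : ContFun 𝕜 𝔤) p))
      (∑ n ∈ Finset.range (2 * (N + 1) + 1),
        ((n.factorial : 𝕜)⁻¹ * (n * (0 : 𝕜) ^ (n - 1)) *
          (dlamFG V hN ((LieAlgebra.ad 𝕜 𝔤 x ^ n) y) (lamFG V hN ((0 : 𝕜) • x) φ) : ContFun 𝕜 𝔤) p +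
        (n.factorial : 𝕜)⁻¹ * (0 : 𝕜) ^ n *
          (dlamFG V hN ((LieAlgebra.ad 𝕜 𝔤 x ^ n) y) (dlamFG V hN x φ) : ContFun 𝕜 𝔤) p)) 0 :=
    HasDerivAt.fun_sum fun n _ => ((hasDerivAt_pow n (0 : 𝕜)).const_mul _).mul (hflow _)
  have key := hleft.unique (hright.congr_of_eventuallyEq (Eventually.of_forall hexp))
  -- The terms `n = 0` and `n = 1` are split off; at `t = 0` those with `n ≥ 2` vanish.
  rw [show 2 * (N + 1) + 1 = (2 * N + 1) + 1 + 1 by ring, Finset.sum_range_succ',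
    Finset.sum_range_succ'] at key
  simp only [zero_smul, lamFG_zero, one_apply_eq_self] at key
  rw [Finset.sum_eq_zero fun n _ => by simp] at key
  simp only [zero_add, Nat.factorial_one, Nat.factorial_zero, Nat.cast_one, inv_one, Nat.sub_self,
    pow_zero, pow_one, one_mul, mul_zero, zero_mul, Nat.cast_zero, add_zero, LieAlgebra.ad_apply,
    Module.End.one_apply] at key
  simp only [← evalFG_apply] at key
  rw [← evalFG_apply, ← evalFG_apply, sub_apply, map_sub,
    mul_apply_eq_comp, mul_apply_eq_comp, key]
  ring

end Representation

/-! ### Assembly of the theorem. -/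

theorem theorem2p13 {𝕜 : Type v} [RCLike 𝕜] {𝔤 : Type u} [LieRing 𝔤] [LieAlgebra 𝕜 𝔤]
    [TopologicalSpace 𝔤] [IsTopologicalAddGroup 𝔤] [ContinuousSMul 𝕜 𝔤]
    [Module ℝ 𝔤] [IsScalarTower ℝ 𝕜 𝔤] [LocallyConvexSpace ℝ 𝔤] [T2Space 𝔤]
    [ContinuousLieBracket 𝔤] (N : ℕ) (hN : 1 ≤ N)
    (hN_ne : LieModule.lowerCentralSeries 𝕜 𝔤 𝔤 (N - 1) ≠ ⊥)
    (hN_eq : LieModule.lowerCentralSeries 𝕜 𝔤 𝔤 N = ⊥) :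
    -- (i) the function space
    (IsClosed (FG 𝕜 𝔤 N : Set (ContFun 𝕜 𝔤)) ∧
      FG 𝕜 𝔤 N ≤ ContPoly 𝕜 𝔤 N ∧
      (∀ x : 𝔤, ∀ φ ∈ FG 𝕜 𝔤 N, leftReg 𝕜 N x φ ∈ FG 𝕜 𝔤 N) ∧
      ∀ c : 𝕜, ContFun.mk (fun _ : 𝔤 => c) continuous_const ∈ FG 𝕜 𝔤 N) ∧
    ∃ _ : Group 𝔤, (∀ x y : 𝔤, x * y = bch 𝕜 N x y) ∧
      -- (ii) the group representation
      ∃ lam : 𝔤 →* (FG 𝕜 𝔤 N →L[𝕜] FG 𝕜 𝔤 N),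
        (∀ (x : 𝔤) (φ : FG 𝕜 𝔤 N), (lam x φ : ContFun 𝕜 𝔤) = leftReg 𝕜 N x φ) ∧
        Function.Injective lam ∧
        (∀ φ : FG 𝕜 𝔤 N, IsSmoothMap 𝕜 fun x : 𝔤 => lam x φ) ∧
        (∀ x : 𝔤, (lam x - 1) ^ (2 ^ (N - 1) * N + 1) = 0) ∧
        -- (iii) the derived representation
        ∃ dlam : 𝔤 →ₗ[𝕜] (FG 𝕜 𝔤 N →L[𝕜] FG 𝕜 𝔤 N),
          (∀ x y : 𝔤, dlam ⁅x, y⁆ = dlam x * dlam y - dlam y * dlam x) ∧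
          (∀ (x : 𝔤) (φ : FG 𝕜 𝔤 N), IsLambdaDot 𝕜 N x φ (dlam x φ : ContFun 𝕜 𝔤)) ∧
          (∀ (x : 𝔤) (φ : FG 𝕜 𝔤 N),
            Tendsto (fun t : 𝕜 => t⁻¹ • (lam (t • x) φ - φ)) (𝓝[≠] 0) (𝓝 (dlam x φ))) ∧
          Function.Injective dlam ∧
          ∀ x : 𝔤, dlam x ^ (2 ^ (N - 1) * N + 1) = 0 := by
  have V := LieFiltration.ofLowerCentralSeries hN_eq
  -- The degree bound `N²` is at least as good as the stated one, since `N ≤ 2^(N-1)`.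
  have hdeg : N * N < 2 ^ (N - 1) * N + 1 := by
    have h : N - 1 < 2 ^ (N - 1) := Nat.lt_two_pow_self
    exact Nat.lt_succ_of_le (Nat.mul_le_mul_right N (by lia))
  -- The lower central series is indexed from `0`, so its term `N - 1` is the last nonzero one, and
  -- that term is central.
  obtain ⟨z, hz, hz0⟩ := 
    not_forall₂.mp (mt (LieSubmodule.eq_bot_iff _).mpr hN_ne)
  have hcomm : ∀ y : 𝔤, ⁅z, y⁆ = 0 := by
    intro y
    have h : ⁅y, z⁆ ∈ LieModule.lowerCentralSeries 𝕜 𝔤 𝔤 (N - 1 + 1) := by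
      rw [LieModule.lowerCentralSeries_succ]
      exact LieSubmodule.lie_mem_lie (LieSubmodule.mem_top y) hz
    rw [Nat.sub_add_cancel hN, hN_eq, LieSubmodule.mem_bot] at h
    rw [← lie_skew, h, neg_zero]
  refine ⟨⟨Submodule.isClosed_topologicalClosure _, FG_le_contPoly V hN,
    fun x φ hφ => leftReg_mem_FG V hN x hφ, const_mem_FG hN hz0 hcomm⟩,
    bchGroup V hN, fun _ _ => rfl, ?_⟩
  let _ : Group 𝔤 := bchGroup V hN
  exact ⟨{ toFun := lamFG V hN, map_one' := lamFG_zero V hN, map_mul' := lamFG_bch V hN },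
    fun _ _ => rfl, lamFG_injective V hN, isSmoothMap_lamFG V hN,
    lamFG_sub_one_pow_eq_zero V hN hdeg, dlamFG V hN, dlamFG_lie V hN, isLambdaDot_dlamFG V hN,
    tendsto_slope_lamFG V hN, dlamFG_injective V hN, dlamFG_pow_eq_zero V hN hdeg⟩
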